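/- **Setting.** Let $V=\bigoplus_{n\in\mathbf Z}V_n$ be a vertex operator algebra (VOA) over $\mathbf C$: a $\mathbf Z$-graded vertex algebra with $\dim V_n<\infty$ for all $n$, $V_n=0$ for $n\ll 0$, and a conformal vector whose modes $L(n)$ satisfy the Virasoro relations for some central charge, where $L(0)$ acts on $V_n$ as $n$, $L(-1)$ is the canonical derivation $a\mapsto a(-2)\mathbf 1$, and $L(1)$ satisfies $[L(1),a(n)]=(L(1)a)(n)+(2k-n-2)\,a(n+1)$ for $a\in V_k$. $V$ is of *CFT-type* if $V_0=\mathbf C\mathbf 1$. Put $F_NV=\bigoplus_{n\le N}V_n$. Let $\mathcal H$ be the upper half-plane and $\Gamma=\mathrm{SL}_2(\mathbf Z)$. For $\gamma=\begin{pmatrix}a&b\\c&d\end{pmatrix}\in\Gamma$ and $\tau\in\mathcal H$ put $j(\gamma,\tau)=c\tau+d$, $X(\gamma,\tau)=c/(c\tau+d)$, $K(\gamma,\tau)=\exp(-c\,j(\gamma,\tau)L(1))\,j(\gamma,\tau)^{-2L(0)}$, and for $f:\mathcal H\to V$ put $(f||_k\gamma)(\tau)=j(\gamma,\tau)^{-k}K(\gamma,\tau)^{-1}f(\gamma\tau)$.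 * A map $\mathcal H\to F_NV$ is *holomorphic at the cusp* if it has an expansion $\sum_{n\ge0}a_nq^n$ with $a_n\in F_NV$, $q=e^{2\pi i\tau}$. * $M_k(V)$ is the space of maps $f$ that, for some $N$, are holomorphic maps $\mathcal H\to F_NV$, also at the cusp, and satisfy $f||_k\gamma=f$ for all $\gamma\in\Gamma$. * $Q_k(V)$ is the space of maps $f$ for which there are $N$, $s\ge0$ and maps $Q_0,\dots,Q_s$ (independent of $\gamma$) such that $f$ and all $Q_n$ are holomorphic maps $\mathcal H\to F_NV$, also at the cusp, and $f||_k\gamma=\sum_{n=0}^sX(\gamma,\cdot)^nQ_n$ for all $\gamma\in\Gamma$. * $Q(V)=\bigoplus_{k\in\mathbf Z}Q_{2k}(V)$, as a space of functions on $\mathcal H$, and $Q=\mathbf C[E_2,E_4,E_6]$ is the polynomial algebra in the Eisenstein series of weights $2,4,6$ normalised to have constant term $1$. **Theorem.** Let $V$ be a VOA. 0. The sum of the spaces of functions $Q_{2k}(V)$, $k\in\mathbf Z$, is direct, and the map $\iota:Q\otimes V\to Q(V)$, $f\otimes v\mapsto f(\tau)v$, is a linear isomorphism. Let $\Lambda:Q(V)\to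 Q(V)$ be the operator corresponding under $\iota$ to $$\frac{12}{2\pi i}\frac{\partial}{\partial E_2}\otimes 1+1\otimes L(1).$$ Then $\Lambda$ maps $Q_{2k+2}(V)$ into $Q_{2k}(V)$ for every $k\in\mathbf Z$. 1. For every integer $k\ne0$ the map $\Lambda:Q_{2k+2}(V)\to Q_{2k}(V)$ is surjective. 2. If $V$ is of CFT-type, then $\Lambda:Q_{2k+2}(V)\to Q_{2k}(V)$ is surjective for every $k\in\mathbf Z$, and $\Lambda:Q(V)\to Q(V)$ is surjective. 3. All spaces $Q_{2k}(V)$ and $M_{2k}(V)$, $k\in\mathbf Z$, are finite-dimensional, and $$\dim Q_{2k+2}(V)-\dim Q_{2k}(V)=\dim M_{2k+2}(V)$$ for every integer $k\neq0$; if $V$ is of CFT-type, this equality holds for every $k\in\mathbf Z$. -/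

import Mathlib

open scoped UpperHalfPlane MatrixGroups Manifold TensorProduct

noncomputable section

/-! ### Vertex algebras -/

/-- A vertex algebra over `ℂ` with Fock space `V`.  `VertexOperator.ncoeff (Y a) n` is the mode
`a(n)`, so that `Y(a, z) = ∑ a(n) z ^ (-n-1)`; that `Y a` takes values in Laurent series says
exactly that `Y(a, z)` is a field.  All the sums in the Jacobi identity are finite. -/
structure VertexAlgebra (V : Type*) [AddCommGroup V] [Module ℂ V] where
  /-- the state-field correspondence -/
  Y : V →ₗ[ℂ] VertexOperator ℂ V
  /-- the vacuum -/
  one : V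
  one_ne_zero : one ≠ 0
  creative : ∀ (a : V) (n : ℤ), 0 ≤ n → VertexOperator.ncoeff (Y a) n one = 0
  creates : ∀ a : V, VertexOperator.ncoeff (Y a) (-1) one = a
  jacobi : ∀ (a b c : V) (r s t : ℤ),
    (∑ᶠ i : ℕ, Ring.choose r i •
      VertexOperator.ncoeff (Y (VertexOperator.ncoeff (Y a) (t + i) b)) (r + s - i) c) =
    ∑ᶠ i : ℕ, ((-1 : ℤ) ^ i * Ring.choose t i) •
      (VertexOperator.ncoeff (Y a) (r + t - i) (VertexOperator.ncoeff (Y b) (s + i) c) -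
        ((Int.negOnePow t : ℤˣ) : ℤ) •
          VertexOperator.ncoeff (Y b) (s + t - i) (VertexOperator.ncoeff (Y a) (r + i) c))

namespace VertexAlgebra

variable {V : Type*} [AddCommGroup V] [Module ℂ V] (A : VertexAlgebra V)

/-- The mode `a(n)`. -/
def mode (a : V) (n : ℤ) : Module.End ℂ V := VertexOperator.ncoeff (A.Y a) n

/-- The canonical derivation `D a = a(-2) 1`. -/
def D : Module.End ℂ V where
  toFun a := A.mode a (-2) A.one
  map_add' a b := by simp [mode]
  map_smul' c a := by simp [mode]

end VertexAlgebra

/-- A `ℤ`-graded vertex algebra. -/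
structure GradedVertexAlgebra (V : Type*) [AddCommGroup V] [Module ℂ V] extends
    VertexAlgebra V where
  /-- the homogeneous piece of conformal degree `n` -/
  gr : ℤ → Submodule ℂ V
  isInternal : DirectSum.IsInternal gr
  mode_mem : ∀ (k l n : ℤ) (a b : V), a ∈ gr k → b ∈ gr l →
    toVertexAlgebra.mode a n b ∈ gr (k + l - n - 1)
  finite_gr : ∀ k, FiniteDimensional ℂ (gr k)
  bounded_below : ∃ N : ℤ, ∀ k < N, gr k = ⊥

namespace GradedVertexAlgebra

variable {V : Type*} [AddCommGroup V] [Module ℂ V] (A : GradedVertexAlgebra V)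

theorem bijective_coe : Function.Bijective (DirectSum.coeLinearMap A.gr) := A.isInternal

/-- The operator that acts on the piece of conformal degree `n` as the scalar `φ n`. -/
def scale (φ : ℤ → ℂ) : Module.End ℂ V :=
  DirectSum.coeLinearMap A.gr ∘ₗ
    DirectSum.lmap (fun n => φ n • (LinearMap.id : A.gr n →ₗ[ℂ] A.gr n)) ∘ₗ
    (LinearEquiv.ofBijective (DirectSum.coeLinearMap A.gr) A.bijective_coe).symm.toLinearMap

theorem scale_of_mem (φ : ℤ → ℂ) {n : ℤ} {v : V} (hv : v ∈ A.gr n) :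
    A.scale φ v = φ n • v := by
  have h : (LinearEquiv.ofBijective (DirectSum.coeLinearMap A.gr) A.bijective_coe).symm v =
      DirectSum.lof ℂ ℤ (fun i => A.gr i) n ⟨v, hv⟩ := by
    rw [LinearEquiv.symm_apply_eq, LinearEquiv.ofBijective_apply, DirectSum.coeLinearMap_lof]
  simp only [scale, LinearMap.comp_apply, LinearEquiv.coe_coe, h, DirectSum.lmap_lof,
    DirectSum.coeLinearMap_lof]
  simp

theorem hom_ext {W : Type*} [AddCommGroup W] [Module ℂ W] {f g : V →ₗ[ℂ] W}
    (h : ∀ n, ∀ v ∈ A.gr n, f v = g v) : f = g := by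
  ext v
  have hv : v ∈ ⨆ n, A.gr n := by
    rw [A.isInternal.submodule_iSup_eq_top]; trivial
  induction hv using Submodule.iSup_induction' with
  | mem n v hv => exact h n v hv
  | zero => simp
  | add x y _ _ hx hy => simp [hx, hy]

theorem scale_comp (φ ψ : ℤ → ℂ) : A.scale φ * A.scale ψ = A.scale (fun n => φ n * ψ n) := by
  apply A.hom_ext
  intro n v hv
  rw [Module.End.mul_apply, A.scale_of_mem _ hv, map_smul, A.scale_of_mem _ hv,
    A.scale_of_mem _ hv, smul_smul, mul_comm]

theorem scale_one : A.scale (fun _ => 1) = 1 := by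
  apply A.hom_ext
  intro n v hv
  simp [A.scale_of_mem _ hv]

/-- The Euler operator: `E v = n v` for `v` of conformal degree `n`. -/
def euler : Module.End ℂ V := A.scale (fun n => (n : ℂ))

/-- The truncation `F_N V = ⨁_{n ≤ N} V_n`. -/
def trunc (N : ℤ) : Submodule ℂ V := ⨆ n : {n : ℤ // n ≤ N}, A.gr n

theorem trunc_mono {M N : ℤ} (h : M ≤ N) : A.trunc M ≤ A.trunc N :=
  iSup_le fun n => le_iSup (fun m : {m : ℤ // m ≤ N} => A.gr m) ⟨n.1, n.2.trans h⟩

/-- CFT-type: `V_0 = ℂ 1`. -/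
def IsCFTType : Prop := A.gr 0 = Submodule.span ℂ {A.one}

theorem mem_gr_of_euler {v : V} {n : ℤ} (hv : A.euler v = (n : ℂ) • v) : v ∈ A.gr n := by
  have h1 : A.scale (fun m => if m = n then 1 else 0) v ∈ A.gr n := by
    have hw : v ∈ ⨆ n, A.gr n := by
      rw [A.isInternal.submodule_iSup_eq_top]; trivial
    clear hv
    induction hw using Submodule.iSup_induction' with
    | mem m v hv =>
      rw [A.scale_of_mem _ hv]
      by_cases h : m = n
      · subst h; simpa using hv
      · simp [h]
    | zero => simp
    | add x y _ _ hx hy => rw [map_add]; exact add_mem hx hy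
  have h2 : A.scale (fun m => if m = n then 1 else 0) +
      A.scale (fun m => if m = n then 0 else ((m : ℂ) - n)⁻¹) *
        (A.euler - (n : ℂ) • 1) = 1 := by
    clear h1 hv
    apply A.hom_ext
    intro m v hv
    by_cases h : m = n
    · subst h
      simp [A.scale_of_mem _ hv, euler]
    · have h' : (m : ℂ) - n ≠ 0 := by
        rw [sub_ne_zero]; exact_mod_cast h
      simp [A.scale_of_mem _ hv, euler, h, smul_smul, ← sub_smul]
      rw [mul_inv_cancel₀ h', one_smul]
  have h3 := congrArg (fun T : Module.End ℂ V => T v) h2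
  simp [hv] at h3
  rwa [h3] at h1

end GradedVertexAlgebra

/-- A quasi-vertex operator algebra (QVOA): the representation of `𝔰𝔩₂` is given by
`L(0) = E` (the Euler operator), `L(-1) = D` (the canonical derivation) and `L(1)`. -/
structure QVOA (V : Type*) [AddCommGroup V] [Module ℂ V] extends GradedVertexAlgebra V where
  /-- the lowering operator `L(1)` -/
  L1 : Module.End ℂ V
  euler_D : toGradedVertexAlgebra.euler * toVertexAlgebra.D -
    toVertexAlgebra.D * toGradedVertexAlgebra.euler = toVertexAlgebra.D
  euler_L1 : toGradedVertexAlgebra.euler * L1 - L1 * toGradedVertexAlgebra.euler = -L1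
  L1_D : L1 * toVertexAlgebra.D - toVertexAlgebra.D * L1 = (2 : ℂ) • toGradedVertexAlgebra.euler
  mode_D : ∀ (a : V) (n : ℤ),
    toVertexAlgebra.mode (toVertexAlgebra.D a) n = (-n : ℤ) • toVertexAlgebra.mode a (n - 1)
  D_mode : ∀ (a : V) (n : ℤ),
    toVertexAlgebra.D * toVertexAlgebra.mode a n - toVertexAlgebra.mode a n * toVertexAlgebra.D =
      (-n : ℤ) • toVertexAlgebra.mode a (n - 1)
  L1_mode : ∀ (k : ℤ) (a : V), a ∈ gr k → ∀ n : ℤ,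
    L1 * toVertexAlgebra.mode a n - toVertexAlgebra.mode a n * L1 =
      toVertexAlgebra.mode (L1 a) n + (2 * k - n - 2 : ℤ) • toVertexAlgebra.mode a (n + 1)

/-- A vertex operator algebra (VOA): a QVOA with a conformal vector `ω` whose modes
`L(n) = ω(n+1)` satisfy the Virasoro relations and extend the representation of `𝔰𝔩₂`. -/
structure VOA (V : Type*) [AddCommGroup V] [Module ℂ V] extends QVOA V where
  /-- the conformal vector -/
  ω : V
  /-- the central charge -/
  c : ℂ
  virasoro : ∀ m n : ℤ,
    toVertexAlgebra.mode ω (m + 1) * toVertexAlgebra.mode ω (n + 1) -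
        toVertexAlgebra.mode ω (n + 1) * toVertexAlgebra.mode ω (m + 1) =
      (m - n : ℤ) • toVertexAlgebra.mode ω (m + n + 1) +
        (if m + n = 0 then ((m : ℂ) ^ 3 - m) / 12 * c else 0) • (1 : Module.End ℂ V)
  mode_ω_zero : toVertexAlgebra.mode ω 0 = toVertexAlgebra.D
  mode_ω_one : toVertexAlgebra.mode ω 1 = toGradedVertexAlgebra.euler
  mode_ω_two : toVertexAlgebra.mode ω 2 = L1

namespace QVOA

variable {V : Type*} [AddCommGroup V] [Module ℂ V] (A : QVOA V)

theorem L1_mem {k : ℤ} {v : V} (hv : v ∈ A.gr k) : A.L1 v ∈ A.gr (k - 1) := by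
  apply A.mem_gr_of_euler
  have h := congrArg (fun T : Module.End ℂ V => T v) A.euler_L1
  have he : A.euler v = (k : ℂ) • v := A.scale_of_mem _ hv
  simp only [LinearMap.sub_apply, Module.End.mul_apply, LinearMap.neg_apply, he, map_smul] at h
  rw [sub_eq_iff_eq_add] at h
  rw [h]
  push_cast
  rw [sub_smul, one_smul]
  abel

theorem L1_pow_mem {k : ℤ} {v : V} (hv : v ∈ A.gr k) (n : ℕ) :
    (A.L1 ^ n) v ∈ A.gr (k - n) := by
  induction n with
  | zero => simpa using hv
  | succ n ih =>
    rw [pow_succ', Module.End.mul_apply]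
    have := A.L1_mem ih
    convert this using 2
    push_cast; ring

/-- `L(1)` is locally nilpotent. -/
theorem L1_locally_nilpotent (v : V) : ∃ N : ℕ, ∀ n, N ≤ n → (A.L1 ^ n) v = 0 := by
  have hw : v ∈ ⨆ n, A.gr n := by
    rw [A.isInternal.submodule_iSup_eq_top]; trivial
  induction hw using Submodule.iSup_induction' with
  | mem k v hv =>
    obtain ⟨N, hN⟩ := A.bounded_below
    refine ⟨(k - N + 1).toNat, fun n hn => ?_⟩
    have h := A.L1_pow_mem hv n
    rw [hN _ (by omega)] at h
    simpa using h
  | zero => exact ⟨0, by simp⟩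
  | add x y _ _ hx hy =>
    obtain ⟨N, hN⟩ := hx
    obtain ⟨M, hM⟩ := hy
    refine ⟨max N M, fun n hn => ?_⟩
    rw [map_add, hN n (le_of_max_le_left hn), hM n (le_of_max_le_right hn), add_zero]

theorem expL1_support (z : ℂ) (v : V) :
    (Function.support fun n : ℕ => (z ^ n / (n.factorial : ℂ)) • (A.L1 ^ n) v).Finite := by
  obtain ⟨N, hN⟩ := A.L1_locally_nilpotent v
  refine (Set.finite_lt_nat N).subset fun n hn => ?_
  by_contra h
  exact hn (by simp [hN n (not_lt.mp h)])

/-- The operator `exp(z L(1)) = ∑ zⁿ L(1)ⁿ / n!`; the sum is finite on every vector. -/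
def expL1 (z : ℂ) : Module.End ℂ V where
  toFun v := ∑ᶠ n : ℕ, (z ^ n / (n.factorial : ℂ)) • (A.L1 ^ n) v
  map_add' v w := by
    rw [← finsum_add_distrib (A.expL1_support z v) (A.expL1_support z w)]
    simp
  map_smul' a v := by
    rw [RingHom.id_apply, smul_finsum' a (A.expL1_support z v)]
    simp [smul_smul, mul_comm]

theorem expL1_apply (z : ℂ) (v : V) :
    A.expL1 z v = ∑ᶠ n : ℕ, (z ^ n / (n.factorial : ℂ)) • (A.L1 ^ n) v := rfl

/-- The factor of automorphy `j(γ, τ) = cτ + d`. -/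
def j (γ : SL(2, ℤ)) (τ : ℍ) : ℂ := ((γ 1 0 : ℤ) : ℂ) * (τ : ℂ) + ((γ 1 1 : ℤ) : ℂ)

/-- `X(γ, τ) = c / (cτ + d)`. -/
def X (γ : SL(2, ℤ)) (τ : ℍ) : ℂ := ((γ 1 0 : ℤ) : ℂ) / j γ τ

/-- The cocycle `K(γ, τ) = exp(-c j(γ, τ) L(1)) j(γ, τ) ^ (-2 L(0))`. -/
def K (γ : SL(2, ℤ)) (τ : ℍ) : Module.End ℂ V :=
  A.expL1 (-((γ 1 0 : ℤ) : ℂ) * j γ τ) * A.scale (fun n => j γ τ ^ (-2 * n))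

/-- The inverse of the cocycle, `K(γ, τ)⁻¹ = j(γ, τ) ^ (2 L(0)) exp(c j(γ, τ) L(1))`. -/
def Kinv (γ : SL(2, ℤ)) (τ : ℍ) : Module.End ℂ V :=
  A.scale (fun n => j γ τ ^ (2 * n)) * A.expL1 (((γ 1 0 : ℤ) : ℂ) * j γ τ)

theorem expL1_eq_sum {v : V} {N : ℕ} (hN : ∀ n, N ≤ n → (A.L1 ^ n) v = 0) (z : ℂ) :
    A.expL1 z v = ∑ n ∈ Finset.range N, (z ^ n / (n.factorial : ℂ)) • (A.L1 ^ n) v := by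
  rw [expL1_apply]
  refine finsum_eq_sum_of_support_subset _ fun n hn => ?_
  by_contra h
  exact hn (by simp [hN n (by simpa using h)])

theorem expL1_mul_neg (z : ℂ) : A.expL1 (-z) * A.expL1 z = 1 := by
  ext v
  obtain ⟨N, hN⟩ := A.L1_locally_nilpotent v
  set g : ℕ × ℕ → V := fun p =>
    ((-z) ^ p.1 / (p.1.factorial : ℂ) * (z ^ p.2 / (p.2.factorial : ℂ))) • (A.L1 ^ (p.1 + p.2)) v
    with hg
  have h1 : A.expL1 (-z) (A.expL1 z v) =
      ∑ p ∈ Finset.range (N + 1) ×ˢ Finset.range (N + 1), g p := by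
    have hN' : ∀ n, N + 1 ≤ n → (A.L1 ^ n) v = 0 := fun n hn => hN n (by omega)
    have hN'' : ∀ n, N + 1 ≤ n → (A.L1 ^ n) (A.expL1 z v) = 0 := fun n hn => by
      rw [A.expL1_eq_sum hN', map_sum]
      refine Finset.sum_eq_zero fun m _ => ?_
      rw [map_smul, ← Module.End.mul_apply, ← pow_add, hN _ (by omega), smul_zero]
    rw [A.expL1_eq_sum hN'', Finset.sum_product]
    refine Finset.sum_congr rfl fun m _ => ?_
    rw [A.expL1_eq_sum hN', map_sum, Finset.smul_sum]
    refine Finset.sum_congr rfl fun n _ => ?_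
    rw [map_smul, ← Module.End.mul_apply, ← pow_add, smul_smul]
  have h2 : ∑ p ∈ Finset.range (N + 1) ×ˢ Finset.range (N + 1), g p =
      ∑ p ∈ (Finset.range (N + 1) ×ˢ Finset.range (N + 1)).filter
        (fun p => p.1 + p.2 ∈ Finset.range (N + 1)), g p := by
    rw [Finset.sum_filter_of_ne]
    intro p _ hp
    by_contra h
    exact hp (by simp only [hg]; rw [hN _ (by simp at h; omega), smul_zero])
  have h3 : ∀ k ∈ Finset.range (N + 1),
      ∑ p ∈ ((Finset.range (N + 1) ×ˢ Finset.range (N + 1)).filter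
        (fun p => p.1 + p.2 ∈ Finset.range (N + 1))).filter (fun p => p.1 + p.2 = k), g p =
      if k = 0 then v else 0 := by
    intro k hk
    have hs : ((Finset.range (N + 1) ×ˢ Finset.range (N + 1)).filter
        (fun p => p.1 + p.2 ∈ Finset.range (N + 1))).filter (fun p => p.1 + p.2 = k) =
        Finset.HasAntidiagonal.antidiagonal k := by
      ext p
      simp at hk ⊢
      omega
    rw [hs]
    have hsum : ∑ p ∈ Finset.HasAntidiagonal.antidiagonal k, g p =
        (((-z + z) ^ k) / (k.factorial : ℂ)) • (A.L1 ^ k) v := by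
      rw [(Commute.all (-z) z).add_pow', Finset.sum_div, Finset.sum_smul]
      refine Finset.sum_congr rfl fun p hp => ?_
      have hp' := Finset.HasAntidiagonal.mem_antidiagonal.mp hp
      simp only [hg, hp']
      congr 1
      rw [← hp', Nat.choose_symm_add, Nat.add_choose, nsmul_eq_mul, Nat.cast_div (Nat.factorial_mul_factorial_dvd_factorial_add _ _)
        (by exact_mod_cast Nat.mul_ne_zero (Nat.factorial_ne_zero _) (Nat.factorial_ne_zero _))]
      have e1 : (p.1.factorial : ℂ) ≠ 0 := by exact_mod_cast Nat.factorial_ne_zero _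
      have e2 : (p.2.factorial : ℂ) ≠ 0 := by exact_mod_cast Nat.factorial_ne_zero _
      have e3 : ((p.1 + p.2).factorial : ℂ) ≠ 0 := by exact_mod_cast Nat.factorial_ne_zero _
      push_cast
      field_simp
    rw [hsum, neg_add_cancel]
    by_cases h : k = 0
    · subst h; simp
    · simp [h]
  rw [Module.End.mul_apply, h1, h2, ← Finset.sum_fiberwise_of_maps_to
    (t := Finset.range (N + 1)) (g := fun p : ℕ × ℕ => p.1 + p.2)
    (fun p hp => (Finset.mem_filter.mp hp).2), Finset.sum_congr rfl h3]
  simp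

theorem j_ne_zero (γ : SL(2, ℤ)) (τ : ℍ) : j γ τ ≠ 0 := by
  have h := UpperHalfPlane.denom_ne_zero (γ : GL (Fin 2) ℝ) τ
  simpa [UpperHalfPlane.denom, j] using h

theorem K_mul_Kinv (γ : SL(2, ℤ)) (τ : ℍ) : A.K γ τ * A.Kinv γ τ = 1 := by
  have h : A.scale (fun n => j γ τ ^ (-2 * n)) * A.scale (fun n => j γ τ ^ (2 * n)) = 1 := by
    rw [A.scale_comp, ← A.scale_one]
    congr 1
    ext n
    rw [← zpow_add₀ (j_ne_zero γ τ)]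
    simp
  rw [K, Kinv, mul_assoc, ← mul_assoc (A.scale _), h, one_mul, neg_mul, A.expL1_mul_neg]

theorem Kinv_mul_K (γ : SL(2, ℤ)) (τ : ℍ) : A.Kinv γ τ * A.K γ τ = 1 := by
  have h : A.scale (fun n => j γ τ ^ (2 * n)) * A.scale (fun n => j γ τ ^ (-2 * n)) = 1 := by
    rw [A.scale_comp, ← A.scale_one]
    congr 1
    ext n
    rw [← zpow_add₀ (j_ne_zero γ τ)]
    simp
  have h' := A.expL1_mul_neg (-((γ 1 0 : ℤ) : ℂ) * j γ τ)
  rw [neg_mul, neg_neg] at h'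
  rw [K, Kinv, mul_assoc, ← mul_assoc (A.expL1 _), neg_mul, h', one_mul, h]

/-! ### `V`-valued modular and quasi-modular forms -/

/-- The weight `k` action `(f ‖ₖ γ)(τ) = j(γ, τ) ^ (-k) K(γ, τ)⁻¹ f(γ τ)` of `SL(2, ℤ)`. -/
def slash (k : ℤ) (γ : SL(2, ℤ)) (f : ℍ → V) (τ : ℍ) : V :=
  j γ τ ^ (-k) • A.Kinv γ τ (f (γ • τ))

/-- The space of maps `ℍ → F_N V` that are holomorphic and have a holomorphic `q`-expansion
`f(τ) = ∑_{n ≥ 0} aₙ qⁿ` with `aₙ ∈ F_N V`, where `q = exp(2πiτ)`.  As `F_N V` is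
finite-dimensional, holomorphy and convergence are tested against linear functionals. -/
def holomorphicMaps (N : ℤ) : Submodule ℂ (ℍ → V) where
  carrier := {f | (∀ τ, f τ ∈ A.trunc N) ∧
    (∀ l : Module.Dual ℂ V, MDiff (fun τ : ℍ => l (f τ))) ∧
    ∃ a : ℕ → V, (∀ n, a n ∈ A.trunc N) ∧ ∀ (l : Module.Dual ℂ V) (τ : ℍ),
      HasSum (fun n : ℕ => l (a n) * Complex.exp (2 * Real.pi * Complex.I * τ) ^ n) (l (f τ))}
  add_mem' := by
    rintro f g ⟨hf, hf', a, ha, ha'⟩ ⟨hg, hg', b, hb, hb'⟩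
    refine ⟨fun τ => add_mem (hf τ) (hg τ), fun l => ?_, fun n => a n + b n,
      fun n => add_mem (ha n) (hb n), fun l τ => ?_⟩
    · simpa using! (hf' l).add (hg' l)
    · simpa [add_mul] using (ha' l τ).add (hb' l τ)
  zero_mem' := ⟨by simp, fun l => by simp [mdifferentiable_const], 0, by simp,
    fun l τ => by simp⟩
  smul_mem' := by
    rintro c f ⟨hf, hf', a, ha, ha'⟩
    refine ⟨fun τ => Submodule.smul_mem _ c (hf τ), fun l => ?_, fun n => c • a n,
      fun n => Submodule.smul_mem _ c (ha n), fun l τ => ?_⟩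
    · simpa using! (hf' l).const_smul c
    · simpa [mul_assoc] using (ha' l τ).mul_left c

theorem holomorphicMaps_mono {M N : ℤ} (h : M ≤ N) :
    A.holomorphicMaps M ≤ A.holomorphicMaps N := by
  rintro f ⟨hf, hf', a, ha, ha'⟩
  exact ⟨fun τ => A.trunc_mono h (hf τ), hf', a, fun n => A.trunc_mono h (ha n), ha'⟩

/-- `M_k(V)`: the holomorphic `V`-valued modular forms of weight `k`. -/
def modularForms (k : ℤ) : Submodule ℂ (ℍ → V) where
  carrier := {f | ∃ N : ℤ, f ∈ A.holomorphicMaps N ∧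
    ∀ (γ : SL(2, ℤ)) (τ : ℍ), A.slash k γ f τ = f τ}
  add_mem' := by
    rintro f g ⟨N, hf, hf'⟩ ⟨M, hg, hg'⟩
    refine ⟨max N M, add_mem (A.holomorphicMaps_mono (le_max_left _ _) hf)
      (A.holomorphicMaps_mono (le_max_right _ _) hg), fun γ τ => ?_⟩
    rw [Pi.add_apply, ← hf' γ τ, ← hg' γ τ]
    simp [slash]
  zero_mem' := ⟨0, zero_mem _, by simp [slash]⟩
  smul_mem' := by
    rintro c f ⟨N, hf, hf'⟩
    refine ⟨N, Submodule.smul_mem _ c hf, fun γ τ => ?_⟩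
    rw [Pi.smul_apply, ← hf' γ τ]
    simp [slash, smul_smul, mul_comm]

/-- `Q_k(V)`: the holomorphic `V`-valued quasi-modular forms of weight `k`, that is the
holomorphic maps `f : ℍ → F_N V` such that `f ‖ₖ γ = ∑_{n ≤ s} X(γ, ·)ⁿ Qₙ` for all
`γ ∈ SL(2, ℤ)`, where the maps `Qₙ : ℍ → F_N V` are holomorphic, also at the cusp, and do not
depend on `γ`. -/
def quasiModularForms (k : ℤ) : Submodule ℂ (ℍ → V) where
  carrier := {f | ∃ (N : ℤ) (s : ℕ) (Q : ℕ → ℍ → V), f ∈ A.holomorphicMaps N ∧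
    (∀ n ≤ s, Q n ∈ A.holomorphicMaps N) ∧
    ∀ (γ : SL(2, ℤ)) (τ : ℍ),
      A.slash k γ f τ = ∑ n ∈ Finset.range (s + 1), X γ τ ^ n • Q n τ}
  add_mem' := by
    rintro f g ⟨N, s, P, hf, hP, hf'⟩ ⟨M, t, R, hg, hR, hg'⟩
    have pad : ∀ (u r : ℕ) (_ : u ≤ r) (S : ℕ → ℍ → V) (γ : SL(2, ℤ)) (τ : ℍ),
        ∑ n ∈ Finset.range (u + 1), X γ τ ^ n • S n τ =
        ∑ n ∈ Finset.range (r + 1), X γ τ ^ n • (if n ≤ u then S n else 0) τ := by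
      intro u r hur S γ τ
      rw [← Finset.sum_subset (Finset.range_mono (by omega : u + 1 ≤ r + 1))]
      · refine Finset.sum_congr rfl fun n hn => ?_
        rw [if_pos (by simp at hn; omega)]
      · intro n _ hn
        rw [if_neg (by simp at hn; omega)]
        simp
    refine ⟨max N M, max s t, fun n => (if n ≤ s then P n else 0) + (if n ≤ t then R n else 0),
      add_mem (A.holomorphicMaps_mono (le_max_left _ _) hf)
      (A.holomorphicMaps_mono (le_max_right _ _) hg), fun n _ => ?_, fun γ τ => ?_⟩
    · refine add_mem ?_ ?_
      · split_ifs with h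
        · exact A.holomorphicMaps_mono (le_max_left _ _) (hP n h)
        · exact zero_mem _
      · split_ifs with h
        · exact A.holomorphicMaps_mono (le_max_right _ _) (hR n h)
        · exact zero_mem _
    · have e : A.slash k γ (f + g) τ = A.slash k γ f τ + A.slash k γ g τ := by simp [slash]
      rw [e, hf', hg', pad s (max s t) (le_max_left _ _), pad t (max s t) (le_max_right _ _),
        ← Finset.sum_add_distrib]
      simp [smul_add]
  zero_mem' := ⟨0, 0, 0, zero_mem _, fun _ _ => zero_mem _, by simp [slash]⟩
  smul_mem' := by
    rintro c f ⟨N, s, P, hf, hP, hf'⟩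
    refine ⟨N, s, fun n => c • P n, Submodule.smul_mem _ c hf,
      fun n hn => Submodule.smul_mem _ c (hP n hn), fun γ τ => ?_⟩
    have e : A.slash k γ (c • f) τ = c • A.slash k γ f τ := by
      simp [slash, smul_smul, mul_comm]
    rw [e, hf', Finset.smul_sum]
    simp [smul_smul, mul_comm]

/-- `Q(V) = ⨁ₖ Q_{2k}(V)`, as a space of functions on `ℍ`. -/
def allQuasiModularForms : Submodule ℂ (ℍ → V) := ⨆ k : ℤ, A.quasiModularForms (2 * k)

/-! ### The lowering operator

The algebra `Q = ℂ[E₂, E₄, E₆]` is presented by the polynomial ring in three variables. -/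

/-- The function on `ℍ` given by a polynomial in the Eisenstein series `E₂, E₄, E₆`. -/
def evalEisenstein (τ : ℍ) : MvPolynomial (Fin 3) ℂ →ₐ[ℂ] ℂ :=
  MvPolynomial.aeval ![EisensteinSeries.E2 τ, ModularForm.E₄ τ, ModularForm.E₆ τ]

/-- The map `ι : Q ⊗ V → (ℍ → V)`, `f ⊗ v ↦ f(τ) v`. -/
def iota : MvPolynomial (Fin 3) ℂ ⊗[ℂ] V →ₗ[ℂ] (ℍ → V) :=
  LinearMap.pi fun τ =>
    TensorProduct.lift ((LinearMap.lsmul ℂ V) ∘ₗ (evalEisenstein τ).toLinearMap)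

theorem iota_tmul (p : MvPolynomial (Fin 3) ℂ) (v : V) (τ : ℍ) :
    iota (p ⊗ₜ[ℂ] v) τ = evalEisenstein τ p • v := by
  simp [iota]

/-- The operator `12/(2πi) ∂/∂E₂ ⊗ 1 + 1 ⊗ L(1)` on `Q ⊗ V`. -/
def tensorLowering : Module.End ℂ (MvPolynomial (Fin 3) ℂ ⊗[ℂ] V) :=
  (12 / (2 * Real.pi * Complex.I) : ℂ) •
      TensorProduct.map (MvPolynomial.pderiv (R := ℂ) (0 : Fin 3)).toLinearMap LinearMap.id +
    TensorProduct.map LinearMap.id A.L1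

/-- The lowering operator `Λ` on functions in the image of `ι` (that is, on `Q(V)`),
obtained from the operator on `Q ⊗ V` by transport along the injective map `ι`. -/
def lowering (f : ℍ → V) : ℍ → V := iota (A.tensorLowering (Function.invFun iota f))

end QVOA

end

open scoped UpperHalfPlane MatrixGroups Manifold TensorProduct

noncomputable section

/-! Everything is moved to Q ⊗ V, graded so that E₂, E₄, E₆ have weights 2, 4, 6 and V_m has weight
2m. Let T_k be the part of weight 2k (`isobaricTensor`) and Λ the operator `tensorLowering`. Three
facts carry the proof.

First, ι is injective, because E₂, E₄, E₆ are algebraically independent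
(`eq_zero_of_evalEisenstein`).

Second, for t in T_k the form ι(t) satisfies ι(t) ‖ γ = ι(exp(X Λ) t) (`slash_iota`). Indeed E₂
transforms by the shift E₂ ↦ E₂ + 12X/(2πi), which is the flow of 12/(2πi) ∂/∂E₂, while K⁻¹ = exp(X
L(1)) j^(2L(0)) contributes the flow of L(1). So ι(t) is quasi-modular, and it is modular exactly
when Λt = 0, because X takes infinitely many values at a fixed τ (`slash_iota_eq_iff`). Conversely
every quasi-modular form of weight 2k lies in ι(T_k) (`quasiModularForms_eq`): its coordinates in a
homogeneous basis are scalar quasi-modular forms. These are polynomials in E₂ over the modular forms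
of level one (`exists_isobaric_of_quasiModular`), which are polynomials in E₄ and E₆.

Third, Λ maps T_(k+1) onto T_k (`exists_tensorLowering_eq`): ∂/∂E₂ has the right inverse "integrate
in E₂", and the perturbation by L(1) is harmless since L(1) is locally nilpotent.

The spaces T_k are finite-dimensional, so rank and nullity of Λ on T_(k+1) give the dimension
formula. -/

namespace QVOA

open UpperHalfPlane ModularForm EisensteinSeries

/-! ### Holomorphic periodic functions on the upper half-plane -/

/-- The algebra of holomorphic functions on `ℍ` that are `1`-periodic and bounded at `i∞`. -/
def holomorphicFunctions : Subalgebra ℂ (ℍ → ℂ) where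
  carrier := {f | MDiff f ∧ Function.Periodic (f ∘ ofComplex) (1 : ℝ) ∧ IsBoundedAtImInfty f}
  mul_mem' := by
    rintro f g ⟨hf, hf', hf''⟩ ⟨hg, hg', hg''⟩
    exact ⟨hf.mul hg, hf'.mul hg', hf''.mul hg''⟩
  add_mem' := by
    rintro f g ⟨hf, hf', hf''⟩ ⟨hg, hg', hg''⟩
    exact ⟨hf.add hg, hf'.add hg', hf''.add hg''⟩
  algebraMap_mem' c := ⟨mdifferentiable_const, fun _ => rfl,
    Filter.const_boundedAtFilter _ (c : ℂ)⟩

theorem hasSum_of_mem_holomorphicFunctions {f : ℍ → ℂ} (hf : f ∈ holomorphicFunctions) (τ : ℍ) :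
    HasSum (fun n : ℕ => (qExpansion 1 f).coeff n *
      Complex.exp (2 * Real.pi * Complex.I * τ) ^ n) (f τ) := by
  have := hasSum_qExpansion (h := 1) one_pos hf.2.1 hf.1 hf.2.2 τ
  simpa [Function.Periodic.qParam] using this

theorem mem_holomorphicFunctions_of_hasSum {f : ℍ → ℂ} (hf : MDiff f) {a : ℕ → ℂ}
    (ha : ∀ τ : ℍ, HasSum (fun n : ℕ => a n *
      Complex.exp (2 * Real.pi * Complex.I * τ) ^ n) (f τ)) : f ∈ holomorphicFunctions := by
  refine ⟨hf, fun z => ?_, isBoundedAtImInfty_of_hasSum_qExpansion (h := 1) one_pos (c := a)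
    (by simpa [Function.Periodic.qParam] using ha)⟩
  by_cases hz : 0 < z.im
  · have hz' : 0 < (z + (1 : ℝ)).im := by simpa using hz
    simp only [Function.comp_apply, ofComplex_apply_of_im_pos hz, ofComplex_apply_of_im_pos hz']
    refine (ha _).unique ?_
    convert ha ⟨z, hz⟩ using 4
    have := Complex.exp_periodic (2 * Real.pi * Complex.I * z)
    rw [← this]
    congr 1
    push_cast
    ring
  -- Outside the upper half-plane `ofComplex` takes one default value, so periodicity is trivial
  -- there.
  · have hz' : ¬ 0 < (z + (1 : ℝ)).im := by simpa using hz
    simp only [Function.comp_apply, ofComplex_apply_of_im_nonpos (not_lt.mp hz),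
      ofComplex_apply_of_im_nonpos (not_lt.mp hz')]

theorem modularForm_mem_holomorphicFunctions {k : ℤ} (f : ModularForm 𝒮ℒ k) :
    (f : ℍ → ℂ) ∈ holomorphicFunctions :=
  ⟨f.holo', SlashInvariantFormClass.periodic_comp_ofComplex f one_mem_strictPeriods_SL,
    ModularFormClass.bdd_at_infty f⟩

theorem E2_mem_holomorphicFunctions : E2 ∈ holomorphicFunctions :=
  mem_holomorphicFunctions_of_hasSum E2_mdifferentiable
    (a := fun m => if m = 0 then 1 else -24 * (ArithmeticFunction.sigma 1 m : ℂ)) fun τ => by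
    simpa using hasSum_qExpansion_E2 (z := τ)

/-! ### The factor of automorphy -/

theorem denom_eq_j (γ : SL(2, ℤ)) (τ : ℍ) : denom (γ : GL (Fin 2) ℝ) τ = j γ τ := by
  simp [denom, j]

theorem slash_eq_iff {f : ℍ → ℂ} {k : ℤ} {γ : SL(2, ℤ)} {τ : ℍ} :
    (f ∣[k] γ) τ = f τ ↔ f (γ • τ) = j γ τ ^ k * f τ := by
  rw [SL_slash_apply, denom_eq_j, zpow_neg, mul_inv_eq_iff_eq_mul₀ (zpow_ne_zero _ (j_ne_zero γ τ)),
    mul_comm]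

theorem modularForm_smul {k : ℤ} (f : ModularForm 𝒮ℒ k) (γ : SL(2, ℤ)) (τ : ℍ) :
    f (γ • τ) = j γ τ ^ k * f τ :=
  slash_eq_iff.mp (congrFun (f.slash_action_eq' _ ⟨γ, rfl⟩) τ)

/-- All cusps of SL₂(ℤ) are equivalent to i∞, so boundedness there and invariance give boundedness
at every cusp. -/
theorem exists_modularForm {f : ℍ → ℂ} (hf : f ∈ holomorphicFunctions) {k : ℤ}
    (h : ∀ (γ : SL(2, ℤ)) (τ : ℍ), f (γ • τ) = j γ τ ^ k * f τ) :
    ∃ F : ModularForm 𝒮ℒ k, ⇑F = f := by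
  have h' : ∀ γ : SL(2, ℤ), f ∣[k] γ = f := fun γ => funext fun τ => slash_eq_iff.mpr (h γ τ)
  exact ⟨{ toFun := f
           slash_action_eq' := fun _ ⟨γ, hγ⟩ => hγ ▸ h' γ
           holo' := hf.1
           bdd_at_cusps' := fun {c} hc => by
             rw [Subgroup.IsArithmetic.isCusp_iff_isCusp_SL2Z] at hc
             rw [OnePoint.isBoundedAt_iff_forall_SL2Z hc]
             intro γ _
             rw [h' γ]
             exact hf.2.2 }, rfl⟩

theorem E2_smul (γ : SL(2, ℤ)) (τ : ℍ) :
    E2 (γ • τ) = j γ τ ^ 2 * (E2 τ + 12 / (2 * Real.pi * Complex.I) * X γ τ) := by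
  have h := congrFun (E2_slash_action γ) τ
  rw [SL_slash_apply, denom_eq_j, zpow_neg,
    mul_inv_eq_iff_eq_mul₀ (zpow_ne_zero _ (j_ne_zero γ τ))] at h
  have hj := j_ne_zero γ τ
  have hpi : (Real.pi : ℂ) ≠ 0 := by exact_mod_cast Real.pi_ne_zero
  rw [h]
  simp only [Pi.sub_apply, Pi.smul_apply, D2, denom_eq_j, riemannZeta_two, X, smul_eq_mul]
  have hI : Complex.I ^ 2 = -1 := Complex.I_sq
  field_simp
  linear_combination (-12 * ((γ 1 0 : ℤ) : ℂ)) * hI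

theorem j_mul (γ γ' : SL(2, ℤ)) (τ : ℍ) : j (γ * γ') τ = j γ (γ' • τ) * j γ' τ := by
  have h : ((γ' 1 0 : ℤ) : ℂ) * τ + ((γ' 1 1 : ℤ) : ℂ) ≠ 0 := j_ne_zero γ' τ
  simp only [j, coe_specialLinearGroup_apply, Matrix.SpecialLinearGroup.coe_mul, Matrix.mul_apply,
    Fin.sum_univ_two]
  simp only [algebraMap_int_eq, eq_intCast, Complex.ofReal_intCast]
  push_cast
  field_simp
  ring

/-- X is the logarithmic derivative of j in τ, so this is the logarithmic derivative of `j_mul`,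
with d(γ'τ)/dτ = j(γ', τ)⁻². The proof is the algebraic equivalent, from det γ' = 1. -/
theorem X_mul (γ γ' : SL(2, ℤ)) (τ : ℍ) :
    X (γ * γ') τ = j γ' τ ^ (-2 : ℤ) * X γ (γ' • τ) + X γ' τ := by
  have hj := j_ne_zero γ' τ
  have hj' := j_ne_zero γ (γ' • τ)
  have hdet : ((γ' 0 0 : ℤ) : ℂ) * (γ' 1 1 : ℤ) - (γ' 0 1 : ℤ) * (γ' 1 0 : ℤ) = 1 := by
    have := γ'.det_coe
    rw [Matrix.det_fin_two] at this
    exact_mod_cast this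
  have hγ : j γ (γ' • τ) * j γ' τ = (γ 1 0 : ℤ) * ((γ' 0 0 : ℤ) * (τ : ℂ) + (γ' 0 1 : ℤ)) +
      (γ 1 1 : ℤ) * j γ' τ := by
    rw [← j_mul]
    simp only [j, Matrix.SpecialLinearGroup.coe_mul, Matrix.mul_apply, Fin.sum_univ_two]
    push_cast
    ring
  have hc : (((γ * γ') 1 0 : ℤ) : ℂ) =
      (γ 1 0 : ℤ) * (γ' 0 0 : ℤ) + (γ 1 1 : ℤ) * (γ' 1 0 : ℤ) := by
    simp only [Matrix.SpecialLinearGroup.coe_mul, Matrix.mul_apply, Fin.sum_univ_two]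
    push_cast
    ring
  have hj1 : j γ' τ = (γ' 1 0 : ℤ) * (τ : ℂ) + (γ' 1 1 : ℤ) := rfl
  have key : (((γ * γ') 1 0 : ℤ) : ℂ) * j γ' τ =
      (γ 1 0 : ℤ) + (γ' 1 0 : ℤ) * (j γ (γ' • τ) * j γ' τ) := by
    rw [hc, hγ, hj1]
    linear_combination (γ 1 0 : ℂ) * hdet
  simp only [X, j_mul, zpow_neg]
  norm_cast
  field_simp
  linear_combination key

theorem exists_bottom_row {c d : ℤ} (h : IsCoprime c d) :
    ∃ γ : SL(2, ℤ), γ 1 0 = c ∧ γ 1 1 = d := h.exists_SL2_row 1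

theorem j_one (τ : ℍ) : j 1 τ = 1 := by simp [j]

/-- The bottom rows (1, d) give the distinct values 1/(τ + d). Hence, at a fixed τ, polynomial
identities in X(γ, τ) valid for all γ may be compared coefficient by coefficient. -/
theorem infinite_range_X (τ : ℍ) : (Set.range fun γ : SL(2, ℤ) => X γ τ).Infinite := by
  have h : Function.Injective fun d : ℤ => ((τ : ℂ) + d)⁻¹ := fun d e hde => by
    simpa using hde
  refine (Set.infinite_range_of_injective h).mono ?_
  rintro _ ⟨d, rfl⟩
  obtain ⟨γ, hc, hd⟩ := exists_bottom_row (isCoprime_one_left (x := d))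
  exact ⟨γ, by simp [X, j, hc, hd]⟩

/-! ### Polynomials in the Eisenstein series -/

/-- Half the weights of `E₂, E₄, E₆`. -/
def halfWeight : Fin 3 → ℤ := ![1, 2, 3]

/-- The isobaric polynomials of weight `2k` in the Eisenstein series. -/
abbrev isobaric (k : ℤ) : Submodule ℂ (MvPolynomial (Fin 3) ℂ) :=
  MvPolynomial.weightedHomogeneousSubmodule ℂ halfWeight k

/-- The algebra B is ℂ for the transformation law of p(E₂, E₄, E₆), and the polynomial ring itself
for the dilation that separates the weights. -/
theorem aeval_smul_of_mem_isobaric {B : Type*} [CommRing B] [Algebra ℂ B]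
    {p : MvPolynomial (Fin 3) ℂ} {k : ℤ} (hp : p ∈ isobaric k) {u : ℂ} (hu : u ≠ 0)
    (y : Fin 3 → B) :
    MvPolynomial.aeval (fun i => u ^ halfWeight i • y i) p = u ^ k • MvPolynomial.aeval y p := by
  rw [MvPolynomial.aeval_def, MvPolynomial.aeval_def, MvPolynomial.eval₂_eq', MvPolynomial.eval₂_eq',
    Finset.smul_sum]
  refine Finset.sum_congr rfl fun d hd => ?_
  have hw : Finsupp.weight halfWeight d = k := hp (MvPolynomial.mem_support_iff.mp hd)
  have hu' : ∏ i, (u ^ halfWeight i) ^ d i = u ^ k := by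
    rw [← hw, Finsupp.weight_apply, Finsupp.sum_fintype _ _ (by simp)]
    simp only [Fin.prod_univ_three, Fin.sum_univ_three, nsmul_eq_mul, zpow_add₀ hu,
      ← zpow_natCast, ← zpow_mul, mul_comm]
  simp only [smul_pow, Finset.prod_smul, hu', mul_smul_comm]

theorem evalEisenstein_apply (τ : ℍ) (p : MvPolynomial (Fin 3) ℂ) :
    evalEisenstein τ p = MvPolynomial.aeval ![E2 τ, E₄ τ, E₆ τ] p := rfl

theorem evalEisenstein_smul {p : MvPolynomial (Fin 3) ℂ} {k : ℤ} (hp : p ∈ isobaric k)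
    (γ : SL(2, ℤ)) (τ : ℍ) :
    evalEisenstein (γ • τ) p = j γ τ ^ (2 * k) *
      MvPolynomial.aeval ![E2 τ + 12 / (2 * Real.pi * Complex.I) * X γ τ, E₄ τ, E₆ τ] p := by
  have h := aeval_smul_of_mem_isobaric hp (pow_ne_zero 2 (j_ne_zero γ τ))
    ![E2 τ + 12 / (2 * Real.pi * Complex.I) * X γ τ, E₄ τ, E₆ τ]
  rw [zpow_mul, smul_eq_mul] at *
  norm_cast at *
  rw [← h, evalEisenstein_apply]
  congr 2
  ext i
  fin_cases i
  · simpa [halfWeight] using E2_smul γ τ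
  · change (E₄ : ModularForm 𝒮ℒ 4) (γ • τ) = (j γ τ ^ 2) ^ (2 : ℤ) * E₄ τ
    rw [modularForm_smul, ← zpow_natCast, ← zpow_mul]
    norm_num
  · change (E₆ : ModularForm 𝒮ℒ 6) (γ • τ) = (j γ τ ^ 2) ^ (3 : ℤ) * E₆ τ
    rw [modularForm_smul, ← zpow_natCast, ← zpow_mul]
    norm_num

theorem evalEisenstein_mem_holomorphicFunctions (p : MvPolynomial (Fin 3) ℂ) :
    (fun τ => evalEisenstein τ p) ∈ holomorphicFunctions := by
  induction p using MvPolynomial.induction_on with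
  | C a =>
    simp only [evalEisenstein_apply, MvPolynomial.aeval_C]
    exact holomorphicFunctions.algebraMap_mem a
  | add p q hp hq => simpa using! add_mem hp hq
  | mul_X p i hp =>
    simp only [map_mul]
    refine mul_mem hp ?_
    fin_cases i
    · simpa [evalEisenstein_apply] using! E2_mem_holomorphicFunctions
    · simpa [evalEisenstein_apply] using! modularForm_mem_holomorphicFunctions E₄
    · simpa [evalEisenstein_apply] using! modularForm_mem_holomorphicFunctions E₆

/-! ### Modular forms of level one -/

/-- E₄^b E₆^c has constant term 1, so a multiple of it removes the constant term of a form of the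
same weight. The excluded k = 1 is the one nonnegative integer not of the form 2b + 3c. -/
theorem exists_isobaric_monomial {k : ℤ} (hk : 0 ≤ k) (hk1 : k ≠ 1) :
    ∃ b c : ℕ, (MvPolynomial.X 1 ^ b * MvPolynomial.X 2 ^ c : MvPolynomial (Fin 3) ℂ) ∈
      isobaric k ∧ 4 * (b : ℤ) + 6 * c = 2 * k := by
  obtain ⟨b, c, h⟩ : ∃ b c : ℕ, 2 * (b : ℤ) + 3 * c = k := by
    rcases Int.even_or_odd' k with ⟨m, rfl | rfl⟩
    · exact ⟨m.toNat, 0, by omega⟩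
    · exact ⟨(m - 1).toNat, 1, by omega⟩
  refine ⟨b, c, ?_, by omega⟩
  have h1 := (MvPolynomial.isWeightedHomogeneous_X ℂ halfWeight 1).pow b
  have h2 := (MvPolynomial.isWeightedHomogeneous_X ℂ halfWeight 2).pow c
  have := h1.mul h2
  rw [MvPolynomial.mem_weightedHomogeneousSubmodule]
  convert this using 1
  simp [halfWeight, ← h, mul_comm]

theorem discriminant_mem_isobaric :
    (MvPolynomial.X 1 ^ 3 - MvPolynomial.X 2 ^ 2 : MvPolynomial (Fin 3) ℂ) ∈ isobaric 6 :=
  sub_mem (by simpa [halfWeight] using (MvPolynomial.isWeightedHomogeneous_X ℂ halfWeight 1).pow 3)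
    (by simpa [halfWeight] using (MvPolynomial.isWeightedHomogeneous_X ℂ halfWeight 2).pow 2)

theorem tendsto_evalEisenstein_X {i : Fin 3} (hi : i ≠ 0) :
    Filter.Tendsto (fun τ => evalEisenstein τ (MvPolynomial.X i)) atImInfty (nhds 1) := by
  have key : ∀ (k : ℕ) (hk : 3 ≤ k) (_ : Even k),
      Filter.Tendsto (E hk : ℍ → ℂ) atImInfty (nhds 1) := fun k hk hk2 => by
    have hm := modularForm_mem_holomorphicFunctions (E hk)
    have ha := analyticAt_cuspFunction_zero one_pos hm.2.1 hm.1 hm.2.2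
    have h0 := E_qExpansion_coeff_zero hk hk2
    rw [qExpansion_coeff] at h0
    simp only [Nat.factorial_zero, Nat.cast_one, inv_one, iteratedDeriv_zero, one_mul] at h0
    have := ha.continuousAt.tendsto.comp (qParam_tendsto_atImInfty one_pos)
    rw [h0] at this
    refine this.congr fun τ => ?_
    simpa using eq_cuspFunction τ one_ne_zero hm.2.1
  fin_cases i
  · exact absurd rfl hi
  · simpa [evalEisenstein_apply] using! key 4 (by norm_num) (by decide)
  · simpa [evalEisenstein_apply] using! key 6 (by norm_num) (by decide)

/-- Subtracting a multiple of E₄^b E₆^c leaves a cusp form. Division by Δ = (E₄³ - E₆²)/1728 then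
lowers the weight by 12, that is k by 6. The bound n turns this descent over integers into an
induction; negative weights and weight 2 carry no forms. -/
theorem exists_isobaric_of_modularForm (n : ℕ) : ∀ k : ℤ, k < n → ∀ f : ModularForm 𝒮ℒ (2 * k),
    ∃ p ∈ isobaric k, ∀ τ, f τ = evalEisenstein τ p := by
  induction n with
  | zero =>
    intro k hk f
    have := ModularFormClass.levelOne_neg_weight_eq_zero (k := 2 * k) (by omega) f
    exact ⟨0, zero_mem _, fun τ => by simp [this]⟩
  | succ n ih =>
    intro k hk f
    by_cases hneg : k < 0
    · have := ModularFormClass.levelOne_neg_weight_eq_zero (k := 2 * k) (by omega) f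
      exact ⟨0, zero_mem _, fun τ => by simp [this]⟩
    by_cases h1 : k = 1
    · subst h1
      have := rank_zero_iff_forall_zero.mp levelOne_weight_two_rank_zero f
      exact ⟨0, zero_mem _, fun τ => by simp [this]⟩
    obtain ⟨b, c, hp, hbc⟩ := exists_isobaric_monomial (not_lt.mp hneg) h1
    set p : MvPolynomial (Fin 3) ℂ := MvPolynomial.X 1 ^ b * MvPolynomial.X 2 ^ c
    obtain ⟨G, hG⟩ := exists_modularForm (k := 2 * k) (evalEisenstein_mem_holomorphicFunctions p)
      fun γ τ => by
        rw [evalEisenstein_smul hp]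
        simp [p, evalEisenstein_apply]
    have hG0 : (qExpansion 1 G).coeff 0 = 1 := by
      have hm := modularForm_mem_holomorphicFunctions G
      rw [UpperHalfPlane.qExpansion_coeff_zero one_pos
        (analyticAt_cuspFunction_zero one_pos hm.2.1 hm.1 hm.2.2) hm.2.1]
      refine Filter.Tendsto.limUnder_eq ?_
      rw [hG]
      simpa [p] using! ((tendsto_evalEisenstein_X (i := 1) (by decide)).pow b).mul
        ((tendsto_evalEisenstein_X (i := 2) (by decide)).pow c)
    obtain ⟨g, hg⟩ := sub_smul_isCuspForm f G hG0
    set a := (qExpansion 1 f).coeff 0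
    have hw : 2 * k - 12 = 2 * (k - 6) := by ring
    obtain ⟨q, hq, hq'⟩ := ih (k - 6) (by omega)
      (ModularForm.mcast hw (CuspForm.discriminantEquiv g))
    refine ⟨a • p + (1 / 1728 : ℂ) • ((MvPolynomial.X 1 ^ 3 - MvPolynomial.X 2 ^ 2) * q),
      add_mem (Submodule.smul_mem _ _ hp) (Submodule.smul_mem _ _ ?_), fun τ => ?_⟩
    · have := MvPolynomial.IsWeightedHomogeneous.mul discriminant_mem_isobaric hq
      rwa [add_sub_cancel] at this
    · have e1 : g τ = f τ - a * G τ := by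
        simpa using! DFunLike.congr_fun hg τ
      have e2 := discriminant_mul_discriminantEquiv_apply g τ
      have e3 : CuspForm.discriminantEquiv g τ = evalEisenstein τ q := by simpa using! hq' τ
      have e4 : G τ = evalEisenstein τ p := congrFun hG τ
      rw [e3, discriminant_eq_E₄_cube_sub_E₆_sq, e1, e4] at e2
      simp only [map_add, map_smul, map_mul, map_sub, map_pow, smul_eq_mul]
      have x1 : evalEisenstein τ (MvPolynomial.X 1) = E₄ τ := by simp [evalEisenstein_apply]
      have x2 : evalEisenstein τ (MvPolynomial.X 2) = E₆ τ := by simp [evalEisenstein_apply]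
      rw [x1, x2]
      linear_combination -e2

/-- Holomorphic functions of level one and weight `2k` are isobaric polynomials in the Eisenstein
series. -/
theorem exists_isobaric_of_smul {f : ℍ → ℂ} (hf : f ∈ holomorphicFunctions) {k : ℤ}
    (h : ∀ (γ : SL(2, ℤ)) (τ : ℍ), f (γ • τ) = j γ τ ^ (2 * k) * f τ) :
    ∃ p ∈ isobaric k, ∀ τ, f τ = evalEisenstein τ p := by
  obtain ⟨F, rfl⟩ := exists_modularForm hf h
  exact exists_isobaric_of_modularForm (k + 1).toNat k (by omega) F

/-! ### Algebraic independence of the Eisenstein series -/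

/-- The quotient tends to 1 at i∞ but never equals 1, since Δ has no zero. A finite set of values
other than 1 would stay away from 1. -/
theorem infinite_E₄_cube_div_E₆_sq :
    {t : ℂ | ∃ τ : ℍ, E₄ τ ≠ 0 ∧ E₆ τ ≠ 0 ∧ t = E₄ τ ^ 3 / E₆ τ ^ 2}.Infinite := by
  intro hfin
  have h4 : Filter.Tendsto (fun τ => E₄ τ) atImInfty (nhds 1) := by
    simpa [evalEisenstein_apply] using! tendsto_evalEisenstein_X (i := 1) (by decide)
  have h6 : Filter.Tendsto (fun τ => E₆ τ) atImInfty (nhds 1) := by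
    simpa [evalEisenstein_apply] using! tendsto_evalEisenstein_X (i := 2) (by decide)
  have ht : Filter.Tendsto (fun τ => E₄ τ ^ 3 / E₆ τ ^ 2) atImInfty (nhds 1) := by
    simpa using! (h4.pow 3).div (h6.pow 2) (by simp)
  have hopen := (hfin.subset (Set.sdiff_subset (t := {1}))).isClosed.isOpen_compl
  have hev := ht.eventually (hopen.mem_nhds (by simp))
  obtain ⟨τ, ⟨hτ, h4τ⟩, h6τ⟩ := ((hev.and (h4.eventually_ne one_ne_zero)).and
    (h6.eventually_ne one_ne_zero)).exists
  have h1 : E₄ τ ^ 3 / E₆ τ ^ 2 = 1 := by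
    by_contra hne
    exact hτ ⟨⟨τ, h4τ, h6τ, rfl⟩, hne⟩
  rw [div_eq_one_iff_eq (pow_ne_zero _ h6τ)] at h1
  have := discriminant_eq_E₄_cube_sub_E₆_sq τ
  rw [h1, sub_self, zero_div] at this
  exact discriminant_ne_zero τ this

/-- A relation between the Eisenstein series holds on the orbit of `(E₂, E₄, E₆)(τ)` under
translation and dilation. -/
theorem aeval_eq_zero_of_evalEisenstein {p : MvPolynomial (Fin 3) ℂ}
    (hp : ∀ τ, evalEisenstein τ p = 0) (τ : ℍ) (c u : ℂ) :
    MvPolynomial.aeval ![u ^ 2 * E2 τ + 12 / (2 * Real.pi * Complex.I) * c * u,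
      u ^ 4 * E₄ τ, u ^ 6 * E₆ τ] p = 0 := by
  -- At γτ the relation is the claim with u = j(γ, τ). For fixed c the coprime rows (c, 1 + kc) give
  -- infinitely many such u, so the polynomial in u vanishes identically.
  have h1 : ∀ c : ℤ, c ≠ 0 → ∀ u : ℂ,
      MvPolynomial.aeval ![u ^ 2 * E2 τ + 12 / (2 * Real.pi * Complex.I) * c * u,
        u ^ 4 * E₄ τ, u ^ 6 * E₆ τ] p = 0 := by
    intro c hc
    set R : Polynomial ℂ := MvPolynomial.aeval
      ![Polynomial.X ^ 2 * Polynomial.C (E2 τ) +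
          Polynomial.C (12 / (2 * Real.pi * Complex.I) * c) * Polynomial.X,
        Polynomial.X ^ 4 * Polynomial.C (E₄ τ), Polynomial.X ^ 6 * Polynomial.C (E₆ τ)] p with hR
    have hev : ∀ u, Polynomial.eval u R =
        MvPolynomial.aeval ![u ^ 2 * E2 τ + 12 / (2 * Real.pi * Complex.I) * c * u,
          u ^ 4 * E₄ τ, u ^ 6 * E₆ τ] p := by
      intro u
      rw [← Polynomial.coe_aeval_eq_eval, hR, ← AlgHom.comp_apply, MvPolynomial.comp_aeval]
      congr 2
      ext i
      fin_cases i <;> simp <;> exact mul_comm _ _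
    have hR0 : R = 0 := by
      refine Polynomial.eq_zero_of_infinite_isRoot _ ?_
      have hinj : Function.Injective fun k : ℤ => (c : ℂ) * τ + ((1 + k * c : ℤ) : ℂ) := by
        intro k l hkl
        simpa [hc] using hkl
      refine (Set.infinite_range_of_injective hinj).mono ?_
      rintro _ ⟨k, rfl⟩
      obtain ⟨γ, hγc, hγd⟩ := exists_bottom_row (c := c) (d := 1 + k * c) ⟨-k, 1, by ring⟩
      have hj : j γ τ = (c : ℂ) * τ + ((1 + k * c : ℤ) : ℂ) := by rw [j, hγc, hγd]
      have hX : X γ τ = c / j γ τ := by rw [X, hγc]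
      have := hp (γ • τ)
      rw [Set.mem_ofPred_eq, Polynomial.IsRoot, hev, ← this, evalEisenstein_apply]
      beta_reduce
      rw [← hj]
      congr 2
      have hj0 := j_ne_zero γ τ
      ext i
      fin_cases i
      · change _ = E2 (γ • τ)
        rw [E2_smul, hX]
        change j γ τ ^ 2 * E2 τ + 12 / (2 * Real.pi * Complex.I) * c * j γ τ = _
        have hpi : (Real.pi : ℂ) ≠ 0 := by exact_mod_cast Real.pi_ne_zero
        field_simp
      · exact (modularForm_smul E₄ γ τ).symm
      · exact (modularForm_smul E₆ γ τ).symm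
    intro u
    rw [← hev, hR0, Polynomial.eval_zero]
  set R : Polynomial ℂ := MvPolynomial.aeval
    ![Polynomial.C (u ^ 2 * E2 τ) +
        Polynomial.C (12 / (2 * Real.pi * Complex.I) * u) * Polynomial.X,
      Polynomial.C (u ^ 4 * E₄ τ), Polynomial.C (u ^ 6 * E₆ τ)] p with hR
  have hev : ∀ c, Polynomial.eval c R =
      MvPolynomial.aeval ![u ^ 2 * E2 τ + 12 / (2 * Real.pi * Complex.I) * c * u,
        u ^ 4 * E₄ τ, u ^ 6 * E₆ τ] p := by
    intro u
    rw [← Polynomial.coe_aeval_eq_eval, hR, ← AlgHom.comp_apply, MvPolynomial.comp_aeval]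
    congr 2
    ext i
    fin_cases i
    · simp
      ring
    · simp
    · simp
  -- With u fixed, the expression is a polynomial in c that vanishes at all positive integers.
  have hR0 : R = 0 := by
    refine Polynomial.eq_zero_of_infinite_isRoot _ ?_
    refine (Set.infinite_range_of_injective
      (f := fun n : ℕ => (((n : ℤ) + 1 : ℤ) : ℂ)) fun m n h => ?_).mono ?_
    · simpa using h
    · rintro _ ⟨n, rfl⟩
      rw [Set.mem_ofPred_eq, Polynomial.IsRoot, hev]
      exact h1 _ (by omega) u
  rw [← hev, hR0, Polynomial.eval_zero]

/-- The Eisenstein series `E₂, E₄, E₆` are algebraically independent. -/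
theorem eq_zero_of_evalEisenstein {p : MvPolynomial (Fin 3) ℂ}
    (hp : ∀ τ, evalEisenstein τ p = 0) : p = 0 := by
  -- Two points (x, y) and (E₄, E₆)(τ) with the same cube-to-square quotient differ by a dilation
  -- (u⁴, u⁶), where u² = yE₄/(xE₆). The free parameter c then moves the first coordinate to s.
  have h1 : ∀ (s x y : ℂ) (τ : ℍ), E₄ τ ≠ 0 → E₆ τ ≠ 0 → x ≠ 0 → y ≠ 0 →
      x ^ 3 / y ^ 2 = E₄ τ ^ 3 / E₆ τ ^ 2 → MvPolynomial.aeval ![s, x, y] p = 0 := by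
    intro s x y τ h4 h6 hx hy hxy
    obtain ⟨u, hu⟩ := IsAlgClosed.exists_pow_nat_eq (y * E₄ τ / (x * E₆ τ)) (n := 2) (by norm_num)
    have hu0 : u ≠ 0 := by
      rintro rfl
      have : y * E₄ τ / (x * E₆ τ) ≠ 0 := by positivity
      exact this (by rw [← hu]; norm_num)
    have hpi : (Real.pi : ℂ) ≠ 0 := by exact_mod_cast Real.pi_ne_zero
    have h := aeval_eq_zero_of_evalEisenstein hp τ
      ((s - u ^ 2 * E2 τ) / (12 / (2 * Real.pi * Complex.I) * u)) u
    rw [← h]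
    rw [div_eq_div_iff (by positivity) (by positivity)] at hxy
    congr 2
    ext i
    fin_cases i
    · change s = u ^ 2 * E2 τ + 12 / (2 * Real.pi * Complex.I) *
        ((s - u ^ 2 * E2 τ) / (12 / (2 * Real.pi * Complex.I) * u)) * u
      field_simp
      ring
    · change x = u ^ 4 * E₄ τ
      rw [show u ^ 4 = (u ^ 2) ^ 2 by ring, hu]
      field_simp
      linear_combination hxy
    · change y = u ^ 6 * E₆ τ
      rw [show u ^ 6 = (u ^ 2) ^ 3 by ring, hu]
      field_simp
      linear_combination hxy
  -- For fixed s and y, cube roots turn the infinitely many values of E₄³/E₆² into infinitely many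
  -- roots x.
  have h2 : ∀ s x y : ℂ, y ≠ 0 → MvPolynomial.aeval ![s, x, y] p = 0 := by
    intro s x y hy
    set R : Polynomial ℂ := MvPolynomial.aeval
      ![Polynomial.C s, Polynomial.X, Polynomial.C y] p with hR
    have hev : ∀ x, Polynomial.eval x R = MvPolynomial.aeval ![s, x, y] p := by
      intro u
      rw [← Polynomial.coe_aeval_eq_eval, hR, ← AlgHom.comp_apply, MvPolynomial.comp_aeval]
      congr 2
      ext i
      fin_cases i <;> simp
    have hR0 : R = 0 := by
      refine Polynomial.eq_zero_of_infinite_isRoot _ ?_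
      refine Set.Infinite.mono ?_ (Set.Infinite.of_image (fun x => x ^ 3 / y ^ 2)
        (s := {x | ∃ τ : ℍ, E₄ τ ≠ 0 ∧ E₆ τ ≠ 0 ∧ x ^ 3 / y ^ 2 = E₄ τ ^ 3 / E₆ τ ^ 2})
        (infinite_E₄_cube_div_E₆_sq.mono ?_))
      · rintro x ⟨τ, h4, h6, hx⟩
        rw [Set.mem_ofPred_eq, Polynomial.IsRoot, hev]
        refine h1 s x y τ h4 h6 ?_ hy hx
        rintro rfl
        have : E₄ τ ^ 3 / E₆ τ ^ 2 ≠ 0 := by positivity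
        exact this (by rw [← hx]; norm_num)
      · rintro _ ⟨τ, h4, h6, rfl⟩
        obtain ⟨x, hx⟩ := IsAlgClosed.exists_pow_nat_eq (E₄ τ ^ 3 / E₆ τ ^ 2 * y ^ 2) (n := 3)
          (by norm_num)
        have hx' : x ^ 3 / y ^ 2 = E₄ τ ^ 3 / E₆ τ ^ 2 := by
          rw [hx]
          field_simp
        exact ⟨x, ⟨τ, h4, h6, hx'⟩, hx'⟩
    rw [← hev, hR0, Polynomial.eval_zero]
  refine MvPolynomial.funext_set (fun _ => {0}ᶜ) (fun _ => (Set.finite_singleton 0).infinite_compl)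
    fun x hx => ?_
  have hx' : ![x 0, x 1, x 2] = x := by
    ext i
    fin_cases i <;> rfl
  have := h2 (x 0) (x 1) (x 2) (by simpa using hx 2 trivial)
  rw [hx'] at this
  simpa using this

/-! ### Scalar quasi-modular forms -/

/-- Evaluation of holomorphic functions at a point of `ℍ`. -/
def evalAt (τ : ℍ) : holomorphicFunctions →+* ℂ :=
  (Pi.evalRingHom (fun _ => ℂ) τ).comp holomorphicFunctions.val.toRingHom

@[simp] theorem evalAt_apply (τ : ℍ) (f : holomorphicFunctions) : evalAt τ f = (f : ℍ → ℂ) τ := rfl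

/-- The constant `12 / (2πi)` in the transformation law of `E₂`. -/
abbrev e2Const : ℂ := 12 / (2 * Real.pi * Complex.I)

theorem e2Const_ne_zero : e2Const ≠ 0 := by
  have hpi : (Real.pi : ℂ) ≠ 0 := by exact_mod_cast Real.pi_ne_zero
  simp [hpi]

theorem eq_of_eval_X_eq {P Q : Polynomial ℂ} (τ : ℍ)
    (h : ∀ γ : SL(2, ℤ), P.eval (X γ τ) = Q.eval (X γ τ)) : P = Q :=
  Polynomial.eq_of_infinite_eval_eq P Q <| (infinite_range_X τ).mono <| by
    rintro _ ⟨γ, rfl⟩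
    exact h γ

theorem coeff_taylor_of_coeff_eq_zero {P : Polynomial ℂ} {s : ℕ}
    (h : ∀ m, s < m → P.coeff m = 0) (r : ℂ) :
    (Polynomial.taylor r P).coeff s = P.coeff s := by
  have hle : P.natDegree ≤ s := Polynomial.natDegree_le_iff_coeff_eq_zero.mpr h
  rcases hle.eq_or_lt with rfl | hlt
  · rw [Polynomial.coeff_taylor_natDegree, Polynomial.leadingCoeff]
  · rw [Polynomial.coeff_eq_zero_of_natDegree_lt hlt, Polynomial.coeff_eq_zero_of_natDegree_lt
      (by rwa [Polynomial.natDegree_taylor])]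

/-- The top coefficient of a quasi-modular form is modular. -/
theorem top_coeff_smul {k : ℤ} {f : ℍ → ℂ} {P : Polynomial holomorphicFunctions} {s : ℕ}
    (hs : ∀ m, s < m → P.coeff m = 0)
    (hf : ∀ (γ : SL(2, ℤ)) (τ : ℍ),
      j γ τ ^ (-(2 * k)) * f (γ • τ) = (P.map (evalAt τ)).eval (X γ τ))
    (γ : SL(2, ℤ)) (τ : ℍ) :
    (P.coeff s : ℍ → ℂ) (γ • τ) = j γ τ ^ (2 * (k - s)) * (P.coeff s : ℍ → ℂ) τ := by
  have hj := j_ne_zero γ τ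
  -- Computing f(γ'γτ) in two ways, with the cocycle rules for j and X, gives P_τ(j⁻²X + X(γ, τ)) =
  -- j^(-2k) P_(γτ)(X). The shift does not affect the coefficient of top degree s.
  have h : (Polynomial.taylor (X γ τ) (P.map (evalAt τ))).comp
      (Polynomial.C (j γ τ ^ (-2 : ℤ)) * Polynomial.X) =
      Polynomial.C (j γ τ ^ (-(2 * k))) * P.map (evalAt (γ • τ)) := by
    refine eq_of_eval_X_eq (γ • τ) fun γ' => ?_
    rw [Polynomial.eval_mul, Polynomial.eval_C, ← hf, Polynomial.eval_comp, Polynomial.taylor_apply,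
      Polynomial.eval_comp]
    simp only [Polynomial.eval_mul, Polynomial.eval_C, Polynomial.eval_X, Polynomial.eval_add]
    rw [← X_mul, ← hf, j_mul, mul_zpow, mul_smul]
    ring
  have hc := congrArg (fun R => Polynomial.coeff R s) h
  simp only [Polynomial.comp_C_mul_X_coeff, Polynomial.coeff_C_mul, Polynomial.coeff_map] at hc
  rw [coeff_taylor_of_coeff_eq_zero (fun m hm => by simp [hs m hm])] at hc
  simp only [Polynomial.coeff_map, evalAt_apply] at hc
  have e : j γ τ ^ (2 * (k - s)) = j γ τ ^ (2 * k) * (j γ τ ^ (-2 : ℤ)) ^ s := by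
    rw [← zpow_natCast, ← zpow_mul, ← zpow_add₀ hj]
    congr 1
    ring
  rw [e, mul_assoc, mul_comm _ ((P.coeff s : ℍ → ℂ) τ), hc, ← mul_assoc, ← zpow_add₀ hj]
  simp

/-- Scalar quasi-modular forms of weight `2k` are isobaric polynomials in `E₂, E₄, E₆`. -/
theorem exists_isobaric_of_quasiModular (s : ℕ) : ∀ {k : ℤ} {f : ℍ → ℂ}
    {P : Polynomial holomorphicFunctions} (_ : ∀ m, s ≤ m → P.coeff m = 0)
    (_ : ∀ (γ : SL(2, ℤ)) (τ : ℍ),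
      j γ τ ^ (-(2 * k)) * f (γ • τ) = (P.map (evalAt τ)).eval (X γ τ)),
    ∃ p ∈ isobaric k, ∀ τ, f τ = evalEisenstein τ p := by
  induction s with
  | zero =>
    intro k f P hs hf
    obtain rfl : P = 0 := Polynomial.ext fun m => by simpa using hs m (Nat.zero_le m)
    exact ⟨0, zero_mem _, fun τ => by simpa [j_one] using hf 1 τ⟩
  | succ s ih =>
    intro k f P hs hf
    have htop := top_coeff_smul (fun m hm => hs m hm) hf
    obtain ⟨g, hg, hg'⟩ := exists_isobaric_of_smul (P.coeff s).2 htop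
    -- E₂/`e2Const` transforms with X having coefficient 1. So the polynomial attached to p is g ·
    -- (X + E₂/`e2Const`)^s, with the same top coefficient g as P, and subtracting p lowers the
    -- degree bound.
    set p : MvPolynomial (Fin 3) ℂ := e2Const⁻¹ ^ s • (MvPolynomial.X 0 ^ s * g)
    have hpk : p ∈ isobaric k := by
      refine Submodule.smul_mem _ _ ?_
      have h0 := ((MvPolynomial.isWeightedHomogeneous_X ℂ halfWeight 0).pow s).mul hg
      simpa [halfWeight] using h0
    let e2 : holomorphicFunctions := e2Const⁻¹ • ⟨E2, E2_mem_holomorphicFunctions⟩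
    obtain ⟨q, hq, hq'⟩ := ih (k := k) (f := fun τ => f τ - evalEisenstein τ p)
      (P := P - Polynomial.C (P.coeff s) * (Polynomial.X + Polynomial.C e2) ^ s)
      (fun m hm => by
        rw [Polynomial.coeff_sub, Polynomial.coeff_C_mul, Polynomial.coeff_X_add_C_pow]
        rcases hm.eq_or_lt with rfl | hlt
        · simp
        · rw [hs m hlt, Nat.choose_eq_zero_of_lt hlt]
          simp)
      (fun γ τ => by
        have hX0 : evalEisenstein (γ • τ) (MvPolynomial.X 0) = E2 (γ • τ) := by
          simp [evalEisenstein_apply]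
        have e : j γ τ ^ (2 * (k - s)) = j γ τ ^ (2 * k) * ((j γ τ ^ 2) ^ s)⁻¹ := by
          rw [← zpow_natCast, ← zpow_natCast, ← zpow_mul, ← zpow_neg, ← zpow_add₀ (j_ne_zero γ τ)]
          congr 1
          push_cast
          ring
        have hj := j_ne_zero γ τ
        have hc := e2Const_ne_zero
        have he : e2Const⁻¹ * (E2 τ + e2Const * X γ τ) = X γ τ + e2Const⁻¹ * E2 τ := by
          field_simp
          ring
        rw [mul_sub, hf]
        simp only [p, map_smul, map_mul, map_pow, hX0, ← hg', htop, E2_smul, Polynomial.map_sub,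
          Polynomial.map_mul, Polynomial.map_pow, Polynomial.map_add, Polynomial.map_C,
          Polynomial.map_X, Polynomial.eval_sub, Polynomial.eval_mul, Polynomial.eval_pow,
          Polynomial.eval_add, Polynomial.eval_C, Polynomial.eval_X, evalAt_apply, smul_eq_mul]
        have he2 : (e2 : ℍ → ℂ) τ = e2Const⁻¹ * E2 τ := rfl
        rw [he2, ← he, e, mul_pow, mul_pow, zpow_neg]
        have h1 : j γ τ ^ (2 * k) ≠ 0 := zpow_ne_zero _ hj
        field_simp)
    exact ⟨q + p, add_mem hq hpk, fun τ => by rw [map_add, ← hq']; ring⟩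

/-! ### The grading of `Q ⊗ V` -/

theorem finite_halfWeight (k : ℤ) : {d : Fin 3 →₀ ℕ | Finsupp.weight halfWeight d = k}.Finite := by
  refine (Finsupp.finite_of_degree_le k.toNat).subset fun d hd => ?_
  simp only [Set.mem_ofPred_eq, Finsupp.weight_apply, Finsupp.degree_eq_sum, Fin.sum_univ_three,
    halfWeight] at hd ⊢
  rw [Finsupp.sum_fintype _ _ (by simp), Fin.sum_univ_three] at hd
  simp at hd
  omega

theorem isobaric_eq_bot {k : ℤ} (hk : k < 0) : isobaric k = ⊥ := by
  refine (Submodule.eq_bot_iff _).mpr fun p hp => MvPolynomial.ext _ _ fun d => ?_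
  by_contra h
  have hd : Finsupp.weight halfWeight d = k := hp (by simpa using h)
  rw [Finsupp.weight_apply, Finsupp.sum_fintype _ _ (by simp), Fin.sum_univ_three] at hd
  simp [halfWeight] at hd
  omega

theorem finiteDimensional_isobaric (k : ℤ) : FiniteDimensional ℂ (isobaric k) := by
  have hle : isobaric k ≤ Submodule.span ℂ
      ((fun d => MvPolynomial.monomial d (1 : ℂ)) '' {d | Finsupp.weight halfWeight d = k}) := by
    intro p hp
    rw [p.as_sum]
    refine sum_mem fun d hd => ?_
    rw [← mul_one (p.coeff d), ← smul_eq_mul, ← MvPolynomial.smul_monomial]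
    exact Submodule.smul_mem _ _
      (Submodule.subset_span ⟨d, hp (MvPolynomial.mem_support_iff.mp hd), rfl⟩)
  have := FiniteDimensional.span_of_finite ℂ
    ((finite_halfWeight k).image fun d => MvPolynomial.monomial d (1 : ℂ))
  exact Submodule.finiteDimensional_of_le hle

variable {V : Type*} [AddCommGroup V] [Module ℂ V] (A : QVOA V)

/-- The part of weight `2k` of `Q ⊗ V`, where `V_m` has weight `2m`. -/
def isobaricTensor (k : ℤ) : Submodule ℂ (MvPolynomial (Fin 3) ℂ ⊗[ℂ] V) :=
  ⨆ m : ℤ, Submodule.map₂ (TensorProduct.mk ℂ _ _) (isobaric (k - m)) (A.gr m)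

theorem tmul_mem_isobaricTensor {k m : ℤ} {p : MvPolynomial (Fin 3) ℂ} {v : V}
    (hp : p ∈ isobaric (k - m)) (hv : v ∈ A.gr m) : p ⊗ₜ[ℂ] v ∈ A.isobaricTensor k :=
  Submodule.mem_iSup_of_mem m (Submodule.apply_mem_map₂ _ hp hv)

theorem isobaricTensor_le {k : ℤ} {S : Submodule ℂ (MvPolynomial (Fin 3) ℂ ⊗[ℂ] V)}
    (h : ∀ m : ℤ, ∀ p ∈ isobaric (k - m), ∀ v ∈ A.gr m, p ⊗ₜ[ℂ] v ∈ S) :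
    A.isobaricTensor k ≤ S :=
  iSup_le fun m => Submodule.map₂_le.mpr (h m)

theorem exists_isobaricTensor_eq_bot : ∃ N : ℤ, ∀ k < N, A.isobaricTensor k = ⊥ := by
  obtain ⟨N, hN⟩ := A.bounded_below
  refine ⟨N, fun k hk => eq_bot_iff.mpr (A.isobaricTensor_le fun m p hp v hv => ?_)⟩
  by_cases hm : m < N
  · rw [hN m hm, Submodule.mem_bot] at hv
    simp [hv]
  · rw [isobaric_eq_bot (by omega), Submodule.mem_bot] at hp
    simp [hp]

/-- Only N ≤ m ≤ k contribute: below N the space V_m is zero, and above k the polynomial would have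
negative weight. -/
instance finiteDimensional_isobaricTensor (k : ℤ) : FiniteDimensional ℂ (A.isobaricTensor k) := by
  obtain ⟨N, hN⟩ := A.bounded_below
  have hle : A.isobaricTensor k ≤ ⨆ m ∈ Finset.Icc N k,
      Submodule.map₂ (TensorProduct.mk ℂ _ _) (isobaric (k - m)) (A.gr m) := by
    refine A.isobaricTensor_le fun m p hp v hv => ?_
    by_cases hm : m < N
    · rw [hN m hm, Submodule.mem_bot] at hv
      simp [hv]
    by_cases hm' : k < m
    · rw [isobaric_eq_bot (by omega), Submodule.mem_bot] at hp
      simp [hp]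
    exact Submodule.mem_iSup_of_mem m (Submodule.mem_iSup_of_mem
      (Finset.mem_Icc.mpr ⟨not_lt.mp hm, not_lt.mp hm'⟩) (Submodule.apply_mem_map₂ _ hp hv))
  have h : (⨆ m ∈ Finset.Icc N k,
      Submodule.map₂ (TensorProduct.mk ℂ _ _) (isobaric (k - m)) (A.gr m)).FG := by
    refine Submodule.fg_biSup _ _ fun m _ => Submodule.FG.map₂ _ ?_ ?_
    · exact (Submodule.fg_iff_finiteDimensional _).mpr (finiteDimensional_isobaric _)
    · exact (Submodule.fg_iff_finiteDimensional _).mpr (A.finite_gr m)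
  have := (Submodule.fg_iff_finiteDimensional _).mp h
  exact Submodule.finiteDimensional_of_le hle

/-- The part of weight 2k lies in the eigenspace of the dilation T for the eigenvalue 2^k, and these
eigenvalues are distinct. -/
theorem iSupIndep_isobaricTensor : iSupIndep A.isobaricTensor := by
  let T : Module.End ℂ (MvPolynomial (Fin 3) ℂ ⊗[ℂ] V) := TensorProduct.map
    (MvPolynomial.aeval fun i => (2 : ℂ) ^ halfWeight i •
      (MvPolynomial.X i : MvPolynomial (Fin 3) ℂ)).toLinearMap (A.scale fun n => (2 : ℂ) ^ n)
  have hinj : Function.Injective fun k : ℤ => (2 : ℂ) ^ k := fun k l h => by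
    beta_reduce at h
    have h' : (2 : ℝ) ^ k = 2 ^ l := Complex.ofReal_injective (by push_cast; exact h)
    exact zpow_right_injective₀ (by norm_num) (by norm_num) h'
  refine (T.eigenspaces_iSupIndep.comp hinj).mono fun k => ?_
  refine A.isobaricTensor_le fun m p hp v hv => ?_
  rw [Function.comp_apply, Module.End.mem_eigenspace_iff, TensorProduct.map_tmul,
    A.scale_of_mem _ hv, AlgHom.toLinearMap_apply, aeval_smul_of_mem_isobaric hp two_ne_zero,
    TensorProduct.smul_tmul_smul, ← zpow_add₀ two_ne_zero, MvPolynomial.aeval_X_left_apply]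
  simp

theorem iSup_isobaricTensor : ⨆ k, A.isobaricTensor k = ⊤ := by
  refine Submodule.eq_top_iff'.mpr fun t => ?_
  induction t with
  | zero => exact zero_mem _
  | add x y hx hy => exact add_mem hx hy
  | tmul p v =>
    have hv : v ∈ ⨆ n, A.gr n := by
      rw [A.isInternal.submodule_iSup_eq_top]; trivial
    induction hv using Submodule.iSup_induction' with
    | zero => simp
    | add x y _ _ hx hy => rw [TensorProduct.tmul_add]; exact add_mem hx hy
    | mem m v hv =>
      rw [p.as_sum, TensorProduct.sum_tmul]
      refine sum_mem fun d _ => Submodule.mem_iSup_of_mem (Finsupp.weight halfWeight d + m)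
        (A.tmul_mem_isobaricTensor ?_ hv)
      rw [add_sub_cancel_right]
      exact MvPolynomial.isWeightedHomogeneous_monomial _ _ _ rfl

/-! ### The lowering operator on Q ⊗ V: local nilpotency and surjectivity -/

theorem tensorLowering_tmul (p : MvPolynomial (Fin 3) ℂ) (v : V) :
    A.tensorLowering (p ⊗ₜ[ℂ] v) =
      e2Const • (MvPolynomial.pderiv 0 p ⊗ₜ[ℂ] v) + p ⊗ₜ[ℂ] A.L1 v := by
  simp [tensorLowering]

theorem tensorLowering_mem {k : ℤ} {t : MvPolynomial (Fin 3) ℂ ⊗[ℂ] V}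
    (ht : t ∈ A.isobaricTensor (k + 1)) : A.tensorLowering t ∈ A.isobaricTensor k := by
  suffices h : A.isobaricTensor (k + 1) ≤ (A.isobaricTensor k).comap A.tensorLowering from h ht
  refine A.isobaricTensor_le fun m p hp v hv => ?_
  rw [Submodule.mem_comap, tensorLowering_tmul]
  refine add_mem (Submodule.smul_mem _ _ (A.tmul_mem_isobaricTensor (m := m) ?_ hv))
    (A.tmul_mem_isobaricTensor (m := m - 1) ?_ (A.L1_mem hv))
  · exact MvPolynomial.IsWeightedHomogeneous.pderiv hp (by simp [halfWeight]; ring)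
  · convert hp using 1
    ring_nf

theorem tensorLowering_pow_mem {k : ℤ} (n : ℕ) {t : MvPolynomial (Fin 3) ℂ ⊗[ℂ] V}
    (ht : t ∈ A.isobaricTensor k) : (A.tensorLowering ^ n) t ∈ A.isobaricTensor (k - n) := by
  induction n with
  | zero => simpa using ht
  | succ n ih =>
    rw [pow_succ', Module.End.mul_apply]
    refine A.tensorLowering_mem ?_
    convert ih using 2
    push_cast
    ring

theorem exists_tensorLowering_pow_eq_zero {k : ℤ} {t : MvPolynomial (Fin 3) ℂ ⊗[ℂ] V}
    (ht : t ∈ A.isobaricTensor k) : ∃ s : ℕ, ∀ n, s < n → (A.tensorLowering ^ n) t = 0 := by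
  obtain ⟨N, hN⟩ := A.exists_isobaricTensor_eq_bot
  refine ⟨(k - N).toNat, fun n hn => ?_⟩
  have := A.tensorLowering_pow_mem n ht
  rw [hN _ (by omega)] at this
  simpa using this

/-- Integration with respect to `E₂`. -/
def integrateE2 : Module.End ℂ (MvPolynomial (Fin 3) ℂ) :=
  (MvPolynomial.basisMonomials (Fin 3) ℂ).constr ℂ fun d =>
    MvPolynomial.monomial (d + Finsupp.single 0 1) ((d 0 + 1 : ℂ)⁻¹)

theorem integrateE2_monomial (d : Fin 3 →₀ ℕ) (a : ℂ) :
    integrateE2 (MvPolynomial.monomial d a) =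
      a • MvPolynomial.monomial (d + Finsupp.single 0 1) ((d 0 + 1 : ℂ)⁻¹) := by
  have h : (MvPolynomial.monomial d 1 : MvPolynomial (Fin 3) ℂ) =
      MvPolynomial.basisMonomials (Fin 3) ℂ d := by simp
  have ha : MvPolynomial.monomial d a = a • (MvPolynomial.monomial d 1 : MvPolynomial (Fin 3) ℂ) :=
    by simp [MvPolynomial.smul_monomial]
  rw [ha, map_smul, h, integrateE2, Module.Basis.constr_basis]

theorem pderiv_integrateE2 (p : MvPolynomial (Fin 3) ℂ) :
    MvPolynomial.pderiv 0 (integrateE2 p) = p := by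
  induction p using MvPolynomial.induction_on' with
  | monomial d a =>
    have : (d 0 + 1 : ℂ) ≠ 0 := Nat.cast_add_one_ne_zero (d 0)
    rw [integrateE2_monomial, Derivation.map_smul, MvPolynomial.pderiv_monomial]
    simp [MvPolynomial.smul_monomial, this]
  | add p q hp hq => simp [hp, hq]

theorem integrateE2_mem {k : ℤ} {p : MvPolynomial (Fin 3) ℂ} (hp : p ∈ isobaric k) :
    integrateE2 p ∈ isobaric (k + 1) := by
  rw [p.as_sum, map_sum]
  refine sum_mem fun d hd => ?_
  rw [integrateE2_monomial]
  refine Submodule.smul_mem _ _ (MvPolynomial.isWeightedHomogeneous_monomial _ _ _ ?_)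
  rw [map_add, hp (MvPolynomial.mem_support_iff.mp hd)]
  simp [halfWeight, Finsupp.weight_single]

/-- As `L(1)` is locally nilpotent and `∂/∂E₂` is surjective, the lowering operator is
surjective. -/
theorem exists_tensorLowering_eq {k : ℤ} {t : MvPolynomial (Fin 3) ℂ ⊗[ℂ] V}
    (ht : t ∈ A.isobaricTensor k) : ∃ s ∈ A.isobaricTensor (k + 1), A.tensorLowering s = t := by
  suffices h : A.isobaricTensor k ≤ (A.isobaricTensor (k + 1)).map A.tensorLowering from h ht
  refine A.isobaricTensor_le fun m p hp v hv => ?_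
  obtain ⟨N, hN⟩ := A.L1_locally_nilpotent v
  replace hN := hN N le_rfl
  induction N generalizing m p v with
  | zero =>
    obtain rfl : v = 0 := by simpa using hN
    simp
  | succ N ih =>
    have hI : e2Const⁻¹ • integrateE2 p ∈ isobaric (k + 1 - m) := by
      refine Submodule.smul_mem _ _ ?_
      convert integrateE2_mem hp using 2
      ring
    -- Integration in E₂ solves the equation up to a term with L(1)v in place of v, which is killed
    -- by one power of L(1) fewer.
    have h1 : p ⊗ₜ[ℂ] v = A.tensorLowering ((e2Const⁻¹ • integrateE2 p) ⊗ₜ[ℂ] v) -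
        (e2Const⁻¹ • integrateE2 p) ⊗ₜ[ℂ] A.L1 v := by
      rw [tensorLowering_tmul, Derivation.map_smul, pderiv_integrateE2, TensorProduct.smul_tmul', smul_smul,
        mul_inv_cancel₀ e2Const_ne_zero, one_smul, add_sub_cancel_right]
    rw [h1]
    refine sub_mem ⟨_, A.tmul_mem_isobaricTensor hI hv, rfl⟩
      (ih (m - 1) _ ?_ _ (A.L1_mem hv) ?_)
    · convert hI using 2
      ring
    · rwa [pow_succ, Module.End.mul_apply] at hN

/-! ### The transformation law of `ι(t)` -/

/-- The polynomial `p(E₂ + 12X/(2πi), E₄, E₆)` at `τ`. -/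
def shiftE2 (τ : ℍ) : MvPolynomial (Fin 3) ℂ →ₐ[ℂ] Polynomial ℂ :=
  MvPolynomial.aeval ![Polynomial.C (E2 τ) + Polynomial.C e2Const * Polynomial.X,
    Polynomial.C (E₄ τ), Polynomial.C (E₆ τ)]

theorem eval_shiftE2 (τ : ℍ) (x : ℂ) (p : MvPolynomial (Fin 3) ℂ) :
    (shiftE2 τ p).eval x = MvPolynomial.aeval ![E2 τ + e2Const * x, E₄ τ, E₆ τ] p := by
  rw [← Polynomial.coe_aeval_eq_eval, shiftE2, ← AlgHom.comp_apply, MvPolynomial.comp_aeval]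
  congr 2
  ext i
  fin_cases i <;> simp

theorem derivative_shiftE2 (τ : ℍ) (p : MvPolynomial (Fin 3) ℂ) :
    Polynomial.derivative (shiftE2 τ p) = e2Const • shiftE2 τ (MvPolynomial.pderiv 0 p) := by
  induction p using MvPolynomial.induction_on with
  | C a => simp [shiftE2]
  | add p q hp hq => simp [hp, hq]
  | mul_X p i hp =>
    rw [map_mul, Polynomial.derivative_mul, hp, Derivation.leibniz, map_add, smul_add, smul_eq_mul,
      smul_eq_mul, map_mul, map_mul]
    have hX : Polynomial.derivative (shiftE2 τ (MvPolynomial.X i)) =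
        e2Const • shiftE2 τ (MvPolynomial.pderiv 0 (MvPolynomial.X i)) := by
      fin_cases i <;> simp [shiftE2, Polynomial.smul_eq_C_mul]
    rw [hX, add_comm, mul_smul_comm, smul_mul_assoc, mul_comm (shiftE2 τ (MvPolynomial.X i))]

/-- The polynomial `l(exp(X L(1)) v)`. -/
def expPolynomial (l : Module.Dual ℂ V) (v : V) : Polynomial ℂ :=
  ∑ n ∈ Finset.range (A.L1_locally_nilpotent v).choose,
    Polynomial.monomial n (l ((A.L1 ^ n) v) / n.factorial)

theorem coeff_expPolynomial (l : Module.Dual ℂ V) (v : V) (n : ℕ) :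
    (A.expPolynomial l v).coeff n = l ((A.L1 ^ n) v) / n.factorial := by
  simp only [expPolynomial, Polynomial.finsetSum_coeff, Polynomial.coeff_monomial,
    Finset.sum_ite_eq', Finset.mem_range]
  split_ifs with h
  · rfl
  · rw [(A.L1_locally_nilpotent v).choose_spec n (not_lt.mp h)]
    simp

theorem eval_expPolynomial (l : Module.Dual ℂ V) (v : V) (x : ℂ) :
    (A.expPolynomial l v).eval x = l (A.expL1 x v) := by
  rw [A.expL1_eq_sum (A.L1_locally_nilpotent v).choose_spec, expPolynomial,
    Polynomial.eval_finsetSum, map_sum]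
  refine Finset.sum_congr rfl fun n _ => ?_
  rw [Polynomial.eval_monomial, map_smul, smul_eq_mul]
  ring

theorem derivative_expPolynomial (l : Module.Dual ℂ V) (v : V) :
    Polynomial.derivative (A.expPolynomial l v) = A.expPolynomial l (A.L1 v) := by
  ext n
  rw [Polynomial.coeff_derivative, coeff_expPolynomial, coeff_expPolynomial, pow_succ,
    Module.End.mul_apply, Nat.factorial_succ]
  have : (n + 1 : ℂ) ≠ 0 := Nat.cast_add_one_ne_zero n
  have : (n.factorial : ℂ) ≠ 0 := by exact_mod_cast n.factorial_ne_zero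
  push_cast
  field_simp

/-- The linear map `v ↦ l(exp(X L(1)) v)`. -/
def expPolynomialHom (l : Module.Dual ℂ V) : V →ₗ[ℂ] Polynomial ℂ where
  toFun := A.expPolynomial l
  map_add' v w := by
    ext n
    simp [coeff_expPolynomial, add_div]
  map_smul' a v := by
    ext n
    simp [coeff_expPolynomial, mul_div_assoc]

/-- The linear map `p ⊗ v ↦ p(E₂ + 12X/(2πi), E₄, E₆) l(exp(X L(1)) v)`. -/
def transformPolynomial (l : Module.Dual ℂ V) (τ : ℍ) :
    MvPolynomial (Fin 3) ℂ ⊗[ℂ] V →ₗ[ℂ] Polynomial ℂ :=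
  LinearMap.mul' ℂ (Polynomial ℂ) ∘ₗ
    TensorProduct.map (shiftE2 τ).toLinearMap (A.expPolynomialHom l)

theorem transformPolynomial_tmul (l : Module.Dual ℂ V) (τ : ℍ) (p : MvPolynomial (Fin 3) ℂ)
    (v : V) : A.transformPolynomial l τ (p ⊗ₜ[ℂ] v) = shiftE2 τ p * A.expPolynomial l v := rfl

/-- d/dX acts on the first factor as 12/(2πi) ∂/∂E₂ and on the second as L(1), so the product rule
is the definition of Λ. The Taylor coefficients in X are therefore those of exp(X Λ). -/
theorem derivative_transformPolynomial (l : Module.Dual ℂ V) (τ : ℍ)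
    (t : MvPolynomial (Fin 3) ℂ ⊗[ℂ] V) :
    Polynomial.derivative (A.transformPolynomial l τ t) =
      A.transformPolynomial l τ (A.tensorLowering t) := by
  induction t with
  | zero => simp
  | add x y hx hy => simp [hx, hy]
  | tmul p v =>
    rw [tensorLowering_tmul, map_add, map_smul]
    simp only [transformPolynomial_tmul]
    rw [Polynomial.derivative_mul, derivative_shiftE2, derivative_expPolynomial, smul_mul_assoc]

theorem eval_zero_transformPolynomial (l : Module.Dual ℂ V) (τ : ℍ)
    (t : MvPolynomial (Fin 3) ℂ ⊗[ℂ] V) :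
    (A.transformPolynomial l τ t).eval 0 = l (iota t τ) := by
  induction t with
  | zero => simp
  | add x y hx hy => simp [hx, hy]
  | tmul p v =>
    rw [transformPolynomial_tmul, Polynomial.eval_mul, eval_shiftE2, eval_expPolynomial, iota_tmul,
      evalEisenstein_apply, A.expL1_apply, finsum_eq_single _ 0 (fun n hn => by simp [hn])]
    simp

theorem coeff_transformPolynomial (l : Module.Dual ℂ V) (τ : ℍ)
    (t : MvPolynomial (Fin 3) ℂ ⊗[ℂ] V) (n : ℕ) :
    (A.transformPolynomial l τ t).coeff n =
      l (iota ((A.tensorLowering ^ n) t) τ) / n.factorial := by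
  induction n generalizing t with
  | zero => simp [Polynomial.coeff_zero_eq_eval_zero, eval_zero_transformPolynomial]
  | succ n ih =>
    have h := Polynomial.coeff_derivative (A.transformPolynomial l τ t) n
    rw [derivative_transformPolynomial, ih, ← Module.End.mul_apply, ← pow_succ] at h
    have h1 : (n + 1 : ℂ) ≠ 0 := Nat.cast_add_one_ne_zero n
    have h2 : (n.factorial : ℂ) ≠ 0 := by exact_mod_cast n.factorial_ne_zero
    rw [eq_div_iff (by exact_mod_cast (n + 1).factorial_ne_zero), Nat.factorial_succ]
    rw [div_eq_iff h2] at h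
    push_cast
    rw [h]
    ring

/-- `z ^ (2 L(0)) exp(w L(1)) = exp(w z ^ (-2) L(1)) z ^ (2 L(0))`. -/
theorem scale_mul_expL1 {z : ℂ} (hz : z ≠ 0) (w : ℂ) :
    A.scale (fun n => z ^ (2 * n)) * A.expL1 w =
      A.expL1 (w / z ^ 2) * A.scale (fun n => z ^ (2 * n)) := by
  apply A.hom_ext
  intro m v hv
  obtain ⟨N, hN⟩ := A.L1_locally_nilpotent v
  rw [Module.End.mul_apply, Module.End.mul_apply, A.scale_of_mem _ hv, map_smul,
    A.expL1_eq_sum hN, A.expL1_eq_sum hN, map_sum, Finset.smul_sum]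
  refine Finset.sum_congr rfl fun n _ => ?_
  rw [map_smul, A.scale_of_mem _ (A.L1_pow_mem hv n), smul_smul, smul_smul]
  congr 1
  have : z ^ (2 * (m - n)) = z ^ (2 * m) / (z ^ 2) ^ n := by
    rw [mul_sub, zpow_sub₀ hz, zpow_mul z 2 n]
    norm_cast
  rw [this, div_pow]
  field_simp

/-- Moving j^(2L(0)) past the exponential divides its argument cj by j², which leaves c/j = X. -/
theorem Kinv_eq (γ : SL(2, ℤ)) (τ : ℍ) :
    A.Kinv γ τ = A.expL1 (X γ τ) * A.scale (fun n => j γ τ ^ (2 * n)) := by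
  have hj := j_ne_zero γ τ
  rw [Kinv, A.scale_mul_expL1 hj, X]
  congr 2
  field_simp

/-- The transformation law of `ι(t)` for `t` of weight `2k`. -/
theorem eval_X_transformPolynomial (l : Module.Dual ℂ V) (γ : SL(2, ℤ)) (τ : ℍ) {k : ℤ}
    {t : MvPolynomial (Fin 3) ℂ ⊗[ℂ] V} (ht : t ∈ A.isobaricTensor k) :
    (A.transformPolynomial l τ t).eval (X γ τ) = l (A.slash (2 * k) γ (iota t) τ) := by
  let L : MvPolynomial (Fin 3) ℂ ⊗[ℂ] V →ₗ[ℂ] ℂ :=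
    l ∘ₗ (j γ τ ^ (-(2 * k)) • A.Kinv γ τ) ∘ₗ LinearMap.proj (γ • τ) ∘ₗ iota
  suffices h : A.isobaricTensor k ≤
      LinearMap.eqLocus (Polynomial.leval (X γ τ) ∘ₗ A.transformPolynomial l τ) L from h ht
  refine A.isobaricTensor_le fun m p hp v hv => ?_
  have hj := j_ne_zero γ τ
  change (A.transformPolynomial l τ (p ⊗ₜ[ℂ] v)).eval (X γ τ) =
    l (j γ τ ^ (-(2 * k)) • A.Kinv γ τ (iota (p ⊗ₜ[ℂ] v) (γ • τ)))
  rw [transformPolynomial_tmul, Polynomial.eval_mul, eval_shiftE2, eval_expPolynomial, iota_tmul,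
    evalEisenstein_smul hp, Kinv_eq, Module.End.mul_apply, map_smul (A.scale _), A.scale_of_mem _ hv]
  simp only [map_smul, smul_eq_mul]
  have : j γ τ ^ (2 * (k - m)) = j γ τ ^ (2 * k) * (j γ τ ^ (2 * m))⁻¹ := by
    rw [mul_sub, zpow_sub₀ hj, div_eq_mul_inv]
  rw [this, zpow_neg]
  have h1 := zpow_ne_zero (2 * k) hj
  have h2 := zpow_ne_zero (2 * m) hj
  field_simp

/-- `ι(t) ‖ γ = ∑ X(γ, ·)ⁿ ι(Λⁿ t) / n!`. -/
theorem slash_iota {k : ℤ} {t : MvPolynomial (Fin 3) ℂ ⊗[ℂ] V} (ht : t ∈ A.isobaricTensor k)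
    {s : ℕ} (hs : ∀ n, s < n → (A.tensorLowering ^ n) t = 0) (γ : SL(2, ℤ)) (τ : ℍ) :
    A.slash (2 * k) γ (iota t) τ = ∑ n ∈ Finset.range (s + 1),
      X γ τ ^ n • iota ((n.factorial : ℂ)⁻¹ • (A.tensorLowering ^ n) t) τ := by
  rw [← sub_eq_zero, ← Module.forall_dual_apply_eq_zero_iff ℂ]
  intro l
  have hdeg : (A.transformPolynomial l τ t).natDegree ≤ s :=
    Polynomial.natDegree_le_iff_coeff_eq_zero.mpr fun n hn => by
      rw [coeff_transformPolynomial, hs n hn]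
      simp
  rw [map_sub, sub_eq_zero, ← A.eval_X_transformPolynomial l γ τ ht,
    Polynomial.eval_eq_sum_range' (Nat.lt_succ_of_le hdeg), map_sum]
  refine Finset.sum_congr rfl fun n _ => ?_
  rw [coeff_transformPolynomial]
  simp only [map_smul, Pi.smul_apply, smul_eq_mul]
  ring

/-! ### Injectivity of ι, and modularity as the kernel of Λ -/

theorem iota_injective : Function.Injective (iota (V := V)) := by
  rw [← LinearMap.ker_eq_bot, LinearMap.ker_eq_bot']
  intro t ht
  classical
  let b := Module.Basis.ofVectorSpace ℂ V
  let e := TensorProduct.equivFinsuppOfBasisRight (M := MvPolynomial (Fin 3) ℂ) b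
  have he : ∀ (t : MvPolynomial (Fin 3) ℂ ⊗[ℂ] V) i τ,
      b.coord i (iota t τ) = evalEisenstein τ (e t i) := by
    intro t i τ
    induction t with
    | zero => simp
    | add x y hx hy => simp only [map_add, Pi.add_apply, Finsupp.add_apply, hx, hy]
    | tmul p v =>
      rw [iota_tmul, TensorProduct.equivFinsuppOfBasisRight_apply_tmul_apply]
      simp [mul_comm]
  rw [← e.map_eq_zero_iff]
  ext1 i
  exact eq_zero_of_evalEisenstein fun τ => by rw [← he, ht, Pi.zero_apply, map_zero]

/-- Invariance makes the polynomial in X take one value at infinitely many points. So it is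
constant, and its linear coefficient l(ι(Λt)) vanishes for every functional l. -/
theorem slash_iota_eq_iff {k : ℤ} {t : MvPolynomial (Fin 3) ℂ ⊗[ℂ] V}
    (ht : t ∈ A.isobaricTensor k) :
    (∀ (γ : SL(2, ℤ)) (τ : ℍ), A.slash (2 * k) γ (iota t) τ = iota t τ) ↔
      A.tensorLowering t = 0 := by
  constructor
  · intro h
    refine iota_injective ?_
    funext τ
    rw [map_zero, Pi.zero_apply, ← Module.forall_dual_apply_eq_zero_iff ℂ]
    intro l
    have hl : A.transformPolynomial l τ t =
        Polynomial.C ((A.transformPolynomial l τ t).eval 0) := by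
      refine eq_of_eval_X_eq τ fun γ => ?_
      rw [A.eval_X_transformPolynomial l γ τ ht, h, Polynomial.eval_C,
        eval_zero_transformPolynomial]
    rw [← A.eval_zero_transformPolynomial, ← derivative_transformPolynomial, hl]
    simp
  · intro h γ τ
    have hs : ∀ n, 0 < n → (A.tensorLowering ^ n) t = 0 := fun n hn => by
      obtain ⟨m, rfl⟩ := Nat.exists_eq_succ_of_ne_zero hn.ne'
      rw [pow_succ, Module.End.mul_apply, h, map_zero]
    simpa using A.slash_iota ht hs γ τ

/-! ### `Q_{2k}(V)` is the image of the part of weight `2k` of `Q ⊗ V` -/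

theorem exists_mem_trunc (v : V) : ∃ N, v ∈ A.trunc N := by
  have hv : v ∈ ⨆ n, A.gr n := by
    rw [A.isInternal.submodule_iSup_eq_top]; trivial
  induction hv using Submodule.iSup_induction' with
  | zero => exact ⟨0, zero_mem _⟩
  | add x y _ _ hx hy =>
    obtain ⟨M, hM⟩ := hx
    obtain ⟨N, hN⟩ := hy
    exact ⟨max M N, add_mem (A.trunc_mono (le_max_left _ _) hM)
      (A.trunc_mono (le_max_right _ _) hN)⟩
  | mem n v hv =>
    exact ⟨n, Submodule.mem_iSup_of_mem (⟨n, le_rfl⟩ : {m : ℤ // m ≤ n}) hv⟩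

theorem exists_iota_mem_holomorphicMaps (t : MvPolynomial (Fin 3) ℂ ⊗[ℂ] V) :
    ∃ N, iota t ∈ A.holomorphicMaps N := by
  induction t with
  | zero => exact ⟨0, by rw [map_zero]; exact zero_mem _⟩
  | add x y hx hy =>
    obtain ⟨M, hM⟩ := hx
    obtain ⟨N, hN⟩ := hy
    refine ⟨max M N, ?_⟩
    rw [map_add]
    exact add_mem (A.holomorphicMaps_mono (le_max_left _ _) hM)
      (A.holomorphicMaps_mono (le_max_right _ _) hN)
  | tmul p v =>
    obtain ⟨N, hN⟩ := A.exists_mem_trunc v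
    have hp := evalEisenstein_mem_holomorphicFunctions p
    refine ⟨N, fun τ => ?_, fun l => ?_,
      fun n => (qExpansion 1 fun τ => evalEisenstein τ p).coeff n • v,
      fun n => Submodule.smul_mem _ _ hN, fun l τ => ?_⟩
    · rw [iota_tmul]
      exact Submodule.smul_mem _ _ hN
    · simp only [iota_tmul, map_smul]
      exact hp.1.mul mdifferentiable_const
    · simp only [iota_tmul, map_smul, smul_eq_mul]
      simpa only [mul_right_comm] using
        (hasSum_of_mem_holomorphicFunctions hp τ).mul_right (l v)

theorem dual_mem_holomorphicFunctions {N : ℤ} {f : ℍ → V} (hf : f ∈ A.holomorphicMaps N)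
    (l : Module.Dual ℂ V) : (fun τ => l (f τ)) ∈ holomorphicFunctions := by
  obtain ⟨-, hf, a, -, ha⟩ := hf
  exact mem_holomorphicFunctions_of_hasSum (hf l) (a := fun n => l (a n)) (ha l)

theorem map_iota_le (k : ℤ) :
    (A.isobaricTensor k).map iota ≤ A.quasiModularForms (2 * k) := by
  rintro _ ⟨t, ht, rfl⟩
  obtain ⟨s, hs⟩ := A.exists_tensorLowering_pow_eq_zero ht
  choose M hM using fun n : ℕ =>
    A.exists_iota_mem_holomorphicMaps ((n.factorial : ℂ)⁻¹ • (A.tensorLowering ^ n) t)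
  obtain ⟨N, hN⟩ := ((Finset.range (s + 1)).image M).exists_le
  replace hN : ∀ n ≤ s, M n ≤ N := fun n hn =>
    hN _ (Finset.mem_image_of_mem _ (Finset.mem_range_succ_iff.mpr hn))
  refine ⟨N, s, fun n => iota ((n.factorial : ℂ)⁻¹ • (A.tensorLowering ^ n) t), ?_,
    fun n hn => A.holomorphicMaps_mono (hN n hn) (hM n), A.slash_iota ht hs⟩
  have := hM 0
  simp only [Nat.factorial_zero, Nat.cast_one, inv_one, one_smul, pow_zero,
    Module.End.one_apply] at this
  exact A.holomorphicMaps_mono (hN 0 (Nat.zero_le _)) this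

theorem exists_L1_pow_trunc_eq_zero (N : ℤ) :
    ∃ T : ℕ, ∀ n, T ≤ n → ∀ v ∈ A.trunc N, (A.L1 ^ n) v = 0 := by
  obtain ⟨M, hM⟩ := A.bounded_below
  refine ⟨(N - M + 1).toNat, fun n hn v hv => ?_⟩
  suffices h : A.trunc N ≤ LinearMap.ker (A.L1 ^ n) from h hv
  refine iSup_le fun m w hw => ?_
  have h := A.L1_pow_mem hw n
  rw [hM _ (by have := m.2; omega)] at h
  simpa using h

/-- A basis of `V` that consists of homogeneous vectors. -/
def homogeneousBasis :
    Module.Basis (Σ n, Module.Free.ChooseBasisIndex ℂ (A.gr n)) ℂ V :=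
  A.isInternal.collectedBasis fun n => Module.Free.chooseBasis ℂ (A.gr n)

theorem homogeneousBasis_mem (i : Σ n, Module.Free.ChooseBasisIndex ℂ (A.gr n)) :
    A.homogeneousBasis i ∈ A.gr i.1 :=
  A.isInternal.collectedBasis_mem _ i

theorem coord_scale (φ : ℤ → ℂ) (i : Σ n, Module.Free.ChooseBasisIndex ℂ (A.gr n)) (v : V) :
    A.homogeneousBasis.coord i (A.scale φ v) = φ i.1 * A.homogeneousBasis.coord i v := by
  classical
  have h : A.homogeneousBasis.coord i ∘ₗ A.scale φ = φ i.1 • A.homogeneousBasis.coord i := by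
    refine A.homogeneousBasis.ext fun i' => ?_
    rw [LinearMap.comp_apply, A.scale_of_mem _ (A.homogeneousBasis_mem i'), map_smul,
      LinearMap.smul_apply, Module.Basis.coord_apply, Module.Basis.repr_self, smul_eq_mul,
      smul_eq_mul]
    by_cases h : i' = i
    · rw [h]
    · rw [Finsupp.single_eq_of_ne (Ne.symm h), mul_zero, mul_zero]
  exact DFunLike.congr_fun h v

/-- The set of indices of degree at most `N` is finite. -/
theorem exists_finset_trunc (N : ℤ) :
    ∃ I : Finset (Σ n, Module.Free.ChooseBasisIndex ℂ (A.gr n)), ∀ v ∈ A.trunc N,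
      v = ∑ i ∈ I, A.homogeneousBasis.coord i v • A.homogeneousBasis i := by
  classical
  obtain ⟨M, hM⟩ := A.bounded_below
  have := A.finite_gr
  let I := (Finset.Icc M N).sigma fun n =>
    (Finset.univ : Finset (Module.Free.ChooseBasisIndex ℂ (A.gr n)))
  refine ⟨I, fun v hv => ?_⟩
  have hle : A.trunc N ≤ Submodule.span ℂ (A.homogeneousBasis '' I) := by
    refine iSup_le fun n w hw => ?_
    by_cases hn : n.1 < M
    · rw [hM _ hn, Submodule.mem_bot] at hw
      rw [hw]
      exact zero_mem _
    have h1 := (Module.Free.chooseBasis ℂ (A.gr n)).sum_repr ⟨w, hw⟩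
    have h2 := congrArg (A.gr n).subtype h1
    rw [map_sum] at h2
    change _ = w at h2
    rw [← h2]
    refine sum_mem fun i _ => ?_
    rw [map_smul]
    refine Submodule.smul_mem _ _ (Submodule.subset_span ⟨⟨n, i⟩, ?_, ?_⟩)
    · simpa [I, n.2] using hn
    · simp [homogeneousBasis]
  have hs := (A.homogeneousBasis.mem_span_image).mp (hle hv)
  conv_lhs => rw [← A.homogeneousBasis.linearCombination_repr v, Finsupp.linearCombination_apply]
  exact Finsupp.sum_of_support_subset _ (by exact_mod_cast hs) _ (by simp)

/-- The components of a quasi-modular form with respect to a homogeneous basis are quasi-modular. -/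
theorem exists_isobaric_coord {k : ℤ} {f : ℍ → V} (hf : f ∈ A.quasiModularForms (2 * k))
    (i : Σ n, Module.Free.ChooseBasisIndex ℂ (A.gr n)) :
    ∃ p ∈ isobaric (k - i.1), ∀ τ, A.homogeneousBasis.coord i (f τ) = evalEisenstein τ p := by
  obtain ⟨N, s, Q, hfN, hQ, hf⟩ := hf
  obtain ⟨T, hT⟩ := A.exists_L1_pow_trunc_eq_zero N
  set l := A.homogeneousBasis.coord i
  let R (a b : ℕ) : holomorphicFunctions :=
    if hb : b ≤ s then ((-1) ^ a / (a.factorial : ℂ)) •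
      ⟨fun τ => (l ∘ₗ A.L1 ^ a) (Q b τ), A.dual_mem_holomorphicFunctions (hQ b hb) _⟩ else 0
  have hR : ∀ a b, b ∈ Finset.range (s + 1) → ∀ τ, (R a b : ℍ → ℂ) τ =
      (-1) ^ a / (a.factorial : ℂ) * l ((A.L1 ^ a) (Q b τ)) := fun a b hb τ => by
    simp only [R, dif_pos (Finset.mem_range_succ_iff.mp hb)]
    rfl
  let P : Polynomial holomorphicFunctions := ∑ a ∈ Finset.range T, ∑ b ∈ Finset.range (s + 1),
    Polynomial.C (R a b) * Polynomial.X ^ (a + b)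
  refine exists_isobaric_of_quasiModular (P.natDegree + 1)
    (fun m hm => Polynomial.coeff_eq_zero_of_natDegree_lt hm) fun γ τ => ?_
  have hj := j_ne_zero γ τ
  have hmem : ∑ n ∈ Finset.range (s + 1), X γ τ ^ n • Q n τ ∈ A.trunc N :=
    sum_mem fun n hn => Submodule.smul_mem _ _ ((hQ n (Finset.mem_range_succ_iff.mp hn)).1 τ)
  -- Moving exp(X L(1)) to the right leaves only a diagonal operator on f. Each coordinate of f thus
  -- satisfies a scalar law, of weight lowered by twice the degree of the basis vector, whose right
  -- side is polynomial in X.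
  have h1 : A.scale (fun n => j γ τ ^ (2 * n)) (j γ τ ^ (-(2 * k)) • f (γ • τ)) =
      A.expL1 (-X γ τ) (∑ n ∈ Finset.range (s + 1), X γ τ ^ n • Q n τ) := by
    rw [← hf γ τ, slash, ← map_smul, Kinv_eq, ← Module.End.mul_apply, ← mul_assoc,
      A.expL1_mul_neg, one_mul]
  have h2 := congrArg l h1
  rw [A.coord_scale, map_smul, smul_eq_mul, ← mul_assoc, ← zpow_add₀ hj,
    A.expL1_eq_sum (fun n hn => hT n hn _ hmem)] at h2
  have h3 : -(2 * (k - i.1)) = 2 * i.1 + -(2 * k) := by ring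
  rw [h3, h2]
  simp only [P, Polynomial.map_sum, Polynomial.eval_finsetSum, Polynomial.map_mul,
    Polynomial.map_pow, Polynomial.map_C, Polynomial.map_X, Polynomial.eval_mul, Polynomial.eval_C,
    Polynomial.eval_pow, Polynomial.eval_X, evalAt_apply, map_sum, map_smul, Finset.smul_sum,
    smul_eq_mul]
  refine Finset.sum_congr rfl fun a _ => Finset.sum_congr rfl fun b hb => ?_
  rw [hR a b hb, neg_pow, pow_add]
  ring

/-- The values of f lie in one F_N V, so finitely many coordinates suffice to rebuild f as the image
of a tensor. Each coordinate has the weight complementary to that of its basis vector. -/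
theorem quasiModularForms_eq (k : ℤ) :
    A.quasiModularForms (2 * k) = (A.isobaricTensor k).map iota := by
  refine le_antisymm (fun f hf => ?_) (A.map_iota_le k)
  choose p hp hp' using A.exists_isobaric_coord hf
  obtain ⟨N, s, Q, hfN, -⟩ := hf
  obtain ⟨I, hI⟩ := A.exists_finset_trunc N
  refine ⟨∑ i ∈ I, p i ⊗ₜ[ℂ] A.homogeneousBasis i, sum_mem fun i _ =>
    A.tmul_mem_isobaricTensor (hp i) (A.homogeneousBasis_mem i), ?_⟩
  funext τ
  rw [hI _ (hfN.1 τ), map_sum, Finset.sum_apply]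
  refine Finset.sum_congr rfl fun i _ => ?_
  rw [iota_tmul, hp']

theorem modularForms_le (k : ℤ) : A.modularForms k ≤ A.quasiModularForms k := by
  rintro f ⟨N, hf, h⟩
  exact ⟨N, 0, fun _ => f, hf, fun _ _ => hf, fun γ τ => by simp [h γ τ]⟩

theorem modularForms_eq (k : ℤ) : A.modularForms (2 * k) =
    (A.isobaricTensor k ⊓ LinearMap.ker A.tensorLowering).map iota := by
  refine le_antisymm (fun f hf => ?_) ?_
  · have hq := A.modularForms_le _ hf
    rw [quasiModularForms_eq] at hq
    obtain ⟨t, ht, rfl⟩ := hq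
    obtain ⟨N, -, h⟩ := hf
    exact ⟨t, ⟨ht, (A.slash_iota_eq_iff ht).mp h⟩, rfl⟩
  · rintro _ ⟨t, ⟨ht, ht'⟩, rfl⟩
    obtain ⟨N, hN⟩ := A.exists_iota_mem_holomorphicMaps t
    exact ⟨N, hN, (A.slash_iota_eq_iff ht).mpr ht'⟩

/-! ### Transport along ι: surjectivity and dimensions -/

theorem lowering_iota (t : MvPolynomial (Fin 3) ℂ ⊗[ℂ] V) :
    A.lowering (iota t) = iota (A.tensorLowering t) := by
  rw [lowering, Function.leftInverse_invFun iota_injective]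

theorem allQuasiModularForms_eq : A.allQuasiModularForms = LinearMap.range (iota (V := V)) := by
  simp only [allQuasiModularForms, quasiModularForms_eq]
  rw [← Submodule.map_iSup, iSup_isobaricTensor, Submodule.map_top]

theorem iSupIndep_quasiModularForms :
    iSupIndep fun k : ℤ => A.quasiModularForms (2 * k) := by
  simp only [quasiModularForms_eq]
  exact iota.iSupIndep_map iota_injective A.iSupIndep_isobaricTensor

theorem surjOn_lowering (k : ℤ) : Set.SurjOn A.lowering
    (A.quasiModularForms (2 * k + 2)) (A.quasiModularForms (2 * k)) := by
  rw [show 2 * k + 2 = 2 * (k + 1) by ring, quasiModularForms_eq, quasiModularForms_eq]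
  rintro _ ⟨t, ht, rfl⟩
  obtain ⟨s, hs, rfl⟩ := A.exists_tensorLowering_eq ht
  exact ⟨iota s, ⟨s, hs, rfl⟩, A.lowering_iota s⟩

theorem mapsTo_lowering (k : ℤ) : Set.MapsTo A.lowering
    (A.quasiModularForms (2 * k + 2)) (A.quasiModularForms (2 * k)) := by
  rw [show 2 * k + 2 = 2 * (k + 1) by ring, quasiModularForms_eq, quasiModularForms_eq]
  rintro _ ⟨t, ht, rfl⟩
  exact ⟨_, A.tensorLowering_mem ht, (A.lowering_iota t).symm⟩

theorem surjective_tensorLowering : Function.Surjective A.tensorLowering := by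
  rw [← LinearMap.range_eq_top, eq_top_iff, ← A.iSup_isobaricTensor]
  refine iSup_le fun k t ht => ?_
  obtain ⟨s, -, rfl⟩ := A.exists_tensorLowering_eq ht
  exact ⟨s, rfl⟩

theorem surjOn_lowering_all :
    Set.SurjOn A.lowering A.allQuasiModularForms A.allQuasiModularForms := by
  rw [allQuasiModularForms_eq]
  rintro _ ⟨t, rfl⟩
  obtain ⟨s, rfl⟩ := A.surjective_tensorLowering t
  exact ⟨iota s, ⟨s, rfl⟩, A.lowering_iota s⟩

theorem finiteDimensional_quasiModularForms (k : ℤ) :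
    FiniteDimensional ℂ (A.quasiModularForms (2 * k)) := by
  rw [quasiModularForms_eq]
  infer_instance

theorem finiteDimensional_modularForms (k : ℤ) :
    FiniteDimensional ℂ (A.modularForms (2 * k)) := by
  have := A.finiteDimensional_quasiModularForms k
  exact Submodule.finiteDimensional_of_le (A.modularForms_le (2 * k))

theorem finrank_map_iota (S : Submodule ℂ (MvPolynomial (Fin 3) ℂ ⊗[ℂ] V)) :
    Module.finrank ℂ (S.map iota) = Module.finrank ℂ S :=
  (Submodule.equivMapOfInjective iota iota_injective S).finrank_eq.symm

/-- Rank plus nullity for Λ on T_(k+1): the image is all of T_k, and ι carries the kernel onto the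
modular forms. -/
theorem finrank_quasiModularForms_sub (k : ℤ) :
    (Module.finrank ℂ (A.quasiModularForms (2 * k + 2)) : ℤ) -
      Module.finrank ℂ (A.quasiModularForms (2 * k)) =
    Module.finrank ℂ (A.modularForms (2 * k + 2)) := by
  rw [show 2 * k + 2 = 2 * (k + 1) by ring, quasiModularForms_eq, quasiModularForms_eq,
    modularForms_eq, finrank_map_iota, finrank_map_iota, finrank_map_iota]
  have hrange : LinearMap.range (A.tensorLowering.domRestrict (A.isobaricTensor (k + 1))) =
      A.isobaricTensor k := by
    rw [LinearMap.range_domRestrict]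
    refine le_antisymm ?_ fun t ht => A.exists_tensorLowering_eq ht
    rintro _ ⟨t, ht, rfl⟩
    exact A.tensorLowering_mem ht
  have hker : Module.finrank ℂ
      (LinearMap.ker (A.tensorLowering.domRestrict (A.isobaricTensor (k + 1)))) =
      Module.finrank ℂ ↥(A.isobaricTensor (k + 1) ⊓ LinearMap.ker A.tensorLowering) := by
    rw [← Submodule.map_comap_subtype]
    exact (Submodule.equivMapOfInjective _ (Submodule.subtype_injective _) _).finrank_eq
  have h := LinearMap.finrank_range_add_finrank_ker (K := ℂ) (V := A.isobaricTensor (k + 1))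
    (V₂ := MvPolynomial (Fin 3) ℂ ⊗[ℂ] V)
    (A.tensorLowering.domRestrict (A.isobaricTensor (k + 1)))
  rw [hrange, hker] at h
  rw [← h]
  push_cast
  ring

end QVOA

theorem mainTheorem9 {V : Type*} [AddCommGroup V] [Module ℂ V] (A : VOA V) :
    -- the sum `Q(V) = ⨁ₖ Q_{2k}(V)` of spaces of functions is direct
    (iSupIndep fun k : ℤ => A.quasiModularForms (2 * k)) ∧
    -- the identification `ι : Q ⊗ V ≃ Q(V)` through which `Λ` is defined
    (Function.Injective (QVOA.iota (V := V)) ∧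
      LinearMap.range (QVOA.iota (V := V)) = A.allQuasiModularForms) ∧
    -- `Λ` maps `Q_{2k+2}(V)` into `Q_{2k}(V)`
    (∀ k : ℤ, Set.MapsTo A.lowering
      (A.quasiModularForms (2 * k + 2)) (A.quasiModularForms (2 * k))) ∧
    -- surjectivity
    (∀ k : ℤ, k ≠ 0 → Set.SurjOn A.lowering
      (A.quasiModularForms (2 * k + 2)) (A.quasiModularForms (2 * k))) ∧
    (A.IsCFTType →
      (∀ k : ℤ, Set.SurjOn A.lowering
        (A.quasiModularForms (2 * k + 2)) (A.quasiModularForms (2 * k))) ∧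
      Set.SurjOn A.lowering A.allQuasiModularForms A.allQuasiModularForms) ∧
    -- dimensions
    (∀ k : ℤ, FiniteDimensional ℂ (A.quasiModularForms (2 * k)) ∧
      FiniteDimensional ℂ (A.modularForms (2 * k))) ∧
    (∀ k : ℤ, k ≠ 0 →
      (Module.finrank ℂ (A.quasiModularForms (2 * k + 2)) : ℤ) -
        Module.finrank ℂ (A.quasiModularForms (2 * k)) =
      Module.finrank ℂ (A.modularForms (2 * k + 2))) ∧
    (A.IsCFTType → ∀ k : ℤ,
      (Module.finrank ℂ (A.quasiModularForms (2 * k + 2)) : ℤ) -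
        Module.finrank ℂ (A.quasiModularForms (2 * k)) =
      Module.finrank ℂ (A.modularForms (2 * k + 2))) :=
  ⟨A.iSupIndep_quasiModularForms, ⟨QVOA.iota_injective, A.allQuasiModularForms_eq.symm⟩,
    A.mapsTo_lowering, fun k _ => A.surjOn_lowering k,
    fun _ => ⟨A.surjOn_lowering, A.surjOn_lowering_all⟩,
    fun k => ⟨A.finiteDimensional_quasiModularForms k, A.finiteDimensional_modularForms k⟩,
    fun k _ => A.finrank_quasiModularForms_sub k, fun _ => A.finrank_quasiModularForms_sub⟩

end
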